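/- Let $n\ge 0$ be an integer. For $0\le r\le n$, an $r$-dimensional subcube of $\{0,1\}^n$ is a set of the form $\{x\in\{0,1\}^n : x_i=a_i \text{ for all } i\notin J\}$, where $J\subseteq\{1,\dots,n\}$ has $r$ elements and $a\in\{0,1\}^n$. Let $S$ be a uniformly random subset of $\{0,1\}^n$ (each of the $2^{2^n}$ subsets being equally likely), let $X_1=X_1(S)$ be the number of edges ($1$-dimensional subcubes) of $\{0,1\}^n$ contained in $S$, and let $\mu_1(n)=\mathbb E[X_1]$. Then, for every $n$, $$\mathbb E[(X_1-\mu_1(n))^3]=\frac{3n^3 2^n}{64},$$ $$\mathbb E[(X_1-\mu_1(n))^4]=\frac{n2^n}{1024}\bigl(12n^3 2^n+12n^2 2^n+40n^3+3n2^n-48n^2+12n-16\bigr),$$ $$\mathbb E[(X_1-\mu_1(n))^5]=\frac{5n^3 2^n}{1024}\bigl(6n^2 2^n+3n2^n+4n^2-24n+8\bigr),$$ $$\begin{aligned}\mathbb E[(X_1-\mu_1(n))^6]=\frac{n2^n}{32768}\bigl(&120n^5(2^n)^2+180n^4(2^n)^2+1920n^5 2^n+90n^3(2^n)^2-840n^4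 2^n-1792n^5\\&+15n^2(2^n)^2-360n^3 2^n-5280n^4-300n^2 2^n+3840n^3-240n2^n+3840n^2-6720n+4864\bigr).\end{aligned}$$ Moreover, the scaled central moments $$\mathbb E\left[\left(\frac{X_1-\mu_1(n)}{\sqrt{\operatorname{Var}(X_1)}}\right)^k\right]$$ converge, as $n\to\infty$, to $0,3,0,15$ for $k=3,4,5,6$ respectively. -/

import Mathlib

/-- The discrete cube `{0,1}^n`. -/
abbrev Cube (n : ℕ) : Type := Fin n → Bool

/-- `C` is an `r`-dimensional subcube of `{0,1}^n`: for some set `J` of `r` free coordinates and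
some vertex `a`, it consists of all vertices that agree with `a` outside `J`. -/
def IsSubcube {n : ℕ} (r : ℕ) (C : Finset (Cube n)) : Prop :=
  ∃ (J : Finset (Fin n)) (a : Cube n),
    J.card = r ∧ ∀ x : Cube n, x ∈ C ↔ ∀ i, i ∉ J → x i = a i

open Classical in
/-- The finite set of all `r`-dimensional subcubes of `{0,1}^n`. -/
noncomputable def subcubes (n r : ℕ) : Finset (Finset (Cube n)) :=
  Finset.univ.filter (fun C => IsSubcube r C)

open Classical in
/-- The random variable `X_r`: the number of `r`-dimensional subcubes of `{0,1}^n` that are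
contained in the set of vertices `S`. -/
noncomputable def numSubcubes (n r : ℕ) (S : Finset (Cube n)) : ℝ :=
  (((subcubes n r).filter (fun C => C ⊆ S)).card : ℝ)

/-- The law of a uniformly random subset of `{0,1}^n`: the uniform probability measure on the
`2 ^ (2 ^ n)` subsets. -/
noncomputable def randomSubset (n : ℕ) : MeasureTheory.Measure (Finset (Cube n)) :=
  (PMF.uniformOfFintype (Finset (Cube n))).toMeasure

/-- The scaled `k`-th central moment `E[((X_r - μ_r) / √Var(X_r)) ^ k]` of `X_r`. -/
noncomputable def scaledCentralMoment (n r k : ℕ) : ℝ :=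
  ∫ S, ((numSubcubes n r S - ∫ T, numSubcubes n r T ∂(randomSubset n)) /
    √(ProbabilityTheory.variance (numSubcubes n r) (randomSubset n))) ^ k ∂(randomSubset n)

/-! Encode `S` by independent fair signs s_x. An edge xy contributes (1 + s_x)(1 + s_y)/4, and for n
≥ 1 the cube is an n-regular bipartite graph between even and odd vertices, so 4(X₁ − μ₁) = n·L +
Σ_{y odd} s_y·w_y, where L = Σ_{x even} s_x and w_y = n + Σ_{x~y} s_x. With the even signs fixed,
this is a constant plus a linear form in the odd signs, whose moments up to order six are
polynomials in n·L and the sums of the w_y², w_y⁴, w_y⁶ (`signMean_linear_pow_six` and its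
companions).

It remains to average over the even signs. With d = n and M = 2^n/2, Σ w_y² = M(d² + d) + 2d²L + Q,
where Q is the quadratic form of the codegree matrix C (`sum_sq_add_linSign`). Flipping all even
signs negates L and fixes Q, so odd terms vanish (`signMean_odd_linSign`). The surviving mixed
moments depend only on d, M and, at orders four and six, on tr C² and (order six) tr C³. Up to here
only biregularity is used.

The two traces are specific to the cube. On even vertices C = A² − nI for the adjacency matrix A;
the characters diagonalise A, and the diagonal entries of A^{2j} are the 2j-th moments of a sum of n
random signs, so the same moment formulas evaluate them.

For the limits, the part of highest degree in 2^n of the fourth and sixth moments is exactly 3·Var²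
and 15·Var³, which leaves an error O(2^{-n}); at orders three and five the square of the scaled
moment is O(2^{-n}). -/

/-- The mean of `F` over the `2 ^ #T` subsets of `T`, all equally likely. -/
noncomputable def signMean {α : Type*} (T : Finset α) (F : Finset α → ℝ) : ℝ :=
  (∑ S ∈ T.powerset, F S) / 2 ^ T.card

open Classical in
/-- The sign `+1` or `-1` that records whether `x` belongs to `S`. -/
noncomputable def memSign {α : Type*} (S : Finset α) (x : α) : ℝ := if x ∈ S then 1 else -1

/-! ### Averages over independent random signs -/

section SignMean

variable {α : Type*} {T : Finset α}

lemma signMean_empty (F : Finset α → ℝ) : signMean ∅ F = F ∅ := by simp [signMean]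

lemma signMean_insert [DecidableEq α] {x : α} (hx : x ∉ T) (F : Finset α → ℝ) :
    signMean (insert x T) F = (signMean T F + signMean T (fun S => F (insert x S))) / 2 := by
  rw [signMean, signMean, signMean, Finset.sum_powerset_insert hx, Finset.card_insert_of_notMem hx,
    pow_succ]
  field_simp

lemma signMean_congr {F G : Finset α → ℝ} (h : ∀ S ⊆ T, F S = G S) :
    signMean T F = signMean T G := by
  unfold signMean
  congr 1
  exact Finset.sum_congr rfl fun S hS => h S (Finset.mem_powerset.1 hS)

lemma signMean_const (c : ℝ) : signMean T (fun _ => c) = c := by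
  simp [signMean]

lemma signMean_add (F G : Finset α → ℝ) :
    signMean T (fun S => F S + G S) = signMean T F + signMean T G := by
  simp [signMean, Finset.sum_add_distrib, add_div]

lemma signMean_const_mul (c : ℝ) (F : Finset α → ℝ) :
    signMean T (fun S => c * F S) = c * signMean T F := by
  simp [signMean, ← Finset.mul_sum, mul_div_assoc]

lemma signMean_sum {ι : Type*} (A : Finset ι) (F : ι → Finset α → ℝ) :
    signMean T (fun S => ∑ i ∈ A, F i S) = ∑ i ∈ A, signMean T (F i) := by
  simp only [signMean]
  rw [Finset.sum_comm, Finset.sum_div]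

lemma memSign_of_mem {S : Finset α} {x : α} (h : x ∈ S) : memSign S x = 1 := by simp [memSign, h]

lemma memSign_of_notMem {S : Finset α} {x : α} (h : x ∉ S) : memSign S x = -1 := by
  simp [memSign, h]

lemma memSign_mul_self (S : Finset α) (x : α) : memSign S x * memSign S x = 1 := by
  by_cases h : x ∈ S <;> simp [memSign, h]

lemma memSign_insert_of_ne [DecidableEq α] {S : Finset α} {x z : α} (h : z ≠ x) :
    memSign (insert x S) z = memSign S z := by
  simp [memSign, h]

/-- The mean over subsets of a disjoint union is an iterated mean. -/
lemma signMean_union [DecidableEq α] {T' : Finset α} (h : Disjoint T T') (F : Finset α → ℝ) :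
    signMean (T ∪ T') F = signMean T (fun S => signMean T' (fun S' => F (S ∪ S'))) := by
  induction T' using Finset.induction_on generalizing F with
  | empty => simp [signMean_empty]
  | insert x T' hx ih =>
    rw [Finset.disjoint_insert_right] at h
    have hx' : x ∉ T ∪ T' := by simp [h.1, hx]
    rw [Finset.union_insert, signMean_insert hx', ih h.2, ih h.2]
    simp only [signMean_insert hx, Finset.union_insert]
    rw [← signMean_add]
    have := signMean_const_mul (T := T) (1 / 2) (fun S => signMean T' (fun S' => F (S ∪ S')) +
      signMean T' (fun S' => F (insert x (S ∪ S'))))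
    rw [div_eq_inv_mul, ← one_div, ← this]
    congr 1
    ext S
    ring

/-- A function that changes sign under complementation has mean zero. -/
lemma signMean_eq_zero_of_odd {F : Finset α → ℝ} (G : Finset α → ℝ)
    (h : ∀ S ⊆ T, F S = G S)
    (hodd : ∀ S S' : Finset α, (∀ x ∈ T, memSign S' x = -memSign S x) → G S' = -G S) :
    signMean T F = 0 := by
  classical
  have key : ∑ S ∈ T.powerset, F S = ∑ S ∈ T.powerset, -F S := by
    refine Finset.sum_nbij' (fun S => T \ S) (fun S => T \ S) ?_ ?_ ?_ ?_ ?_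
    · intro S _
      simp
    · intro S _
      simp
    · intro S hS
      simpa using Finset.mem_powerset.1 hS
    · intro S hS
      simpa using Finset.mem_powerset.1 hS
    · intro S hS
      rw [h S (Finset.mem_powerset.1 hS), h _ Finset.sdiff_subset, hodd S (T \ S), neg_neg]
      intro x hx
      by_cases hxS : x ∈ S <;> simp [memSign, hx, hxS]
  rw [Finset.sum_neg_distrib] at key
  rw [signMean, show ∑ S ∈ T.powerset, F S = 0 by linarith, zero_div]

/-- Averaging a function of a weighted sum of signs over one of the signs. -/
lemma signMean_insert_weighted [DecidableEq α] {x : α} (hx : x ∉ T) (w : α → ℝ) (g : ℝ → ℝ → ℝ) :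
    signMean (insert x T) (fun S => g (memSign S x) (∑ z ∈ insert x T, w z * memSign S z)) =
      (signMean T (fun S => g (-1) (-w x + ∑ z ∈ T, w z * memSign S z)) +
        signMean T (fun S => g 1 (w x + ∑ z ∈ T, w z * memSign S z))) / 2 := by
  rw [signMean_insert hx]
  congr 2
  · refine signMean_congr fun S hS => ?_
    rw [Finset.sum_insert hx, memSign_of_notMem fun h => hx (hS h)]
    simp
  · refine signMean_congr fun S _ => ?_
    rw [Finset.sum_insert hx, memSign_of_mem (Finset.mem_insert_self x S), mul_one]
    congr 2
    refine Finset.sum_congr rfl fun z hz => ?_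
    rw [memSign_insert_of_ne]
    rintro rfl
    exact hx hz

/-! ### Moments of a shifted linear form in random signs -/

section Moments

variable (w : α → ℝ)

/-- The shift `a` is kept general, here and for the higher powers, so that induction on `T` closes:
averaging over the sign at `x` turns `a` into `a ± w x`. -/
lemma signMean_linear_one (a : ℝ) :
    signMean T (fun S => a + ∑ x ∈ T, w x * memSign S x) = a := by
  classical
  induction T using Finset.induction_on generalizing a with
  | empty => simp [signMean_empty]
  | insert x T hx ih =>
    rw [signMean_insert_weighted hx w (fun _ r => a + r)]
    simp only [← add_assoc, ih]
    ring

lemma signMean_linear_sq (a : ℝ) :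
    signMean T (fun S => (a + ∑ x ∈ T, w x * memSign S x) ^ 2) = a ^ 2 + ∑ x ∈ T, w x ^ 2 := by
  classical
  induction T using Finset.induction_on generalizing a with
  | empty => simp [signMean_empty]
  | insert x T hx ih =>
    rw [signMean_insert_weighted hx w (fun _ r => (a + r) ^ 2)]
    simp only [← add_assoc, ih, Finset.sum_insert hx]
    ring

lemma signMean_linear_cube (a : ℝ) :
    signMean T (fun S => (a + ∑ x ∈ T, w x * memSign S x) ^ 3) =
      a ^ 3 + 3 * a * ∑ x ∈ T, w x ^ 2 := by
  classical
  induction T using Finset.induction_on generalizing a with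
  | empty => simp [signMean_empty]
  | insert x T hx ih =>
    rw [signMean_insert_weighted hx w (fun _ r => (a + r) ^ 3)]
    simp only [← add_assoc, ih, Finset.sum_insert hx]
    ring

lemma signMean_linear_pow_four (a : ℝ) :
    signMean T (fun S => (a + ∑ x ∈ T, w x * memSign S x) ^ 4) =
      a ^ 4 + 6 * a ^ 2 * ∑ x ∈ T, w x ^ 2 +
        (3 * (∑ x ∈ T, w x ^ 2) ^ 2 - 2 * ∑ x ∈ T, w x ^ 4) := by
  classical
  induction T using Finset.induction_on generalizing a with
  | empty => simp [signMean_empty]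
  | insert x T hx ih =>
    rw [signMean_insert_weighted hx w (fun _ r => (a + r) ^ 4)]
    simp only [← add_assoc, ih, Finset.sum_insert hx]
    ring

lemma signMean_linear_pow_five (a : ℝ) :
    signMean T (fun S => (a + ∑ x ∈ T, w x * memSign S x) ^ 5) =
      a ^ 5 + 10 * a ^ 3 * ∑ x ∈ T, w x ^ 2 +
        5 * a * (3 * (∑ x ∈ T, w x ^ 2) ^ 2 - 2 * ∑ x ∈ T, w x ^ 4) := by
  classical
  induction T using Finset.induction_on generalizing a with
  | empty => simp [signMean_empty]
  | insert x T hx ih =>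
    rw [signMean_insert_weighted hx w (fun _ r => (a + r) ^ 5)]
    simp only [← add_assoc, ih, Finset.sum_insert hx]
    ring

lemma signMean_linear_pow_six (a : ℝ) :
    signMean T (fun S => (a + ∑ x ∈ T, w x * memSign S x) ^ 6) =
      a ^ 6 + 15 * a ^ 4 * ∑ x ∈ T, w x ^ 2 +
        15 * a ^ 2 * (3 * (∑ x ∈ T, w x ^ 2) ^ 2 - 2 * ∑ x ∈ T, w x ^ 4) +
        (15 * (∑ x ∈ T, w x ^ 2) ^ 3 - 30 * (∑ x ∈ T, w x ^ 2) * (∑ x ∈ T, w x ^ 4) +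
          16 * ∑ x ∈ T, w x ^ 6) := by
  classical
  induction T using Finset.induction_on generalizing a with
  | empty => simp [signMean_empty]
  | insert x T hx ih =>
    rw [signMean_insert_weighted hx w (fun _ r => (a + r) ^ 6)]
    simp only [← add_assoc, ih, Finset.sum_insert hx]
    ring

/-- Splitting off the sign at `x` leaves half the difference of the fourth moments with shifts `a +
w x` and `a - w x`. -/
lemma signMean_memSign_mul_pow_four {x : α} (hx : x ∈ T) (a : ℝ) :
    signMean T (fun S => memSign S x * (a + ∑ z ∈ T, w z * memSign S z) ^ 4) =
      w x * (4 * a ^ 3 + 12 * a * ∑ z ∈ T, w z ^ 2 - 8 * a * w x ^ 2) := by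
  classical
  obtain ⟨T, hxT, rfl⟩ : ∃ T', x ∉ T' ∧ T = insert x T' :=
    ⟨T.erase x, Finset.notMem_erase x T, (Finset.insert_erase hx).symm⟩
  rw [signMean_insert_weighted hxT w (fun s r => s * (a + r) ^ 4)]
  simp only [← add_assoc, signMean_const_mul, signMean_linear_pow_four, Finset.sum_insert hxT]
  ring

/-- Splitting off the sign at `x` gives half the difference of two one-sign means, with shifts `a +
w x` and `a - w x`. -/
lemma signMean_memSign_mul_memSign_mul_pow_four {x y : α} (hx : x ∈ T) (hy : y ∈ T) (hxy : x ≠ y)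
    (a : ℝ) :
    signMean T (fun S => memSign S x * memSign S y * (a + ∑ z ∈ T, w z * memSign S z) ^ 4) =
      w x * w y * (12 * a ^ 2 + 12 * (∑ z ∈ T, w z ^ 2) - 8 * w x ^ 2 - 8 * w y ^ 2) := by
  classical
  obtain ⟨T, hxT, rfl⟩ : ∃ T', x ∉ T' ∧ T = insert x T' :=
    ⟨T.erase x, Finset.notMem_erase x T, (Finset.insert_erase hx).symm⟩
  have hyT : y ∈ T := by simpa [hxy.symm] using hy
  rw [signMean_insert hxT]
  have h₁ : signMean T (fun S => memSign S x * memSign S y *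
      (a + ∑ z ∈ insert x T, w z * memSign S z) ^ 4) =
      signMean T (fun S => -1 * (memSign S y * ((a - w x) + ∑ z ∈ T, w z * memSign S z) ^ 4)) := by
    refine signMean_congr fun S hS => ?_
    rw [Finset.sum_insert hxT, memSign_of_notMem fun h => hxT (hS h)]
    ring
  have h₂ : signMean T (fun S => memSign (insert x S) x * memSign (insert x S) y *
      (a + ∑ z ∈ insert x T, w z * memSign (insert x S) z) ^ 4) =
      signMean T (fun S => memSign S y * ((a + w x) + ∑ z ∈ T, w z * memSign S z) ^ 4) := by
    refine signMean_congr fun S _ => ?_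
    have h : ∑ z ∈ T, w z * memSign (insert x S) z = ∑ z ∈ T, w z * memSign S z :=
      Finset.sum_congr rfl fun z hz => by
        rw [memSign_insert_of_ne]
        rintro rfl
        exact hxT hz
    rw [Finset.sum_insert hxT, memSign_of_mem (Finset.mem_insert_self x S),
      memSign_insert_of_ne hxy.symm, h]
    ring
  rw [h₁, h₂]
  simp only [signMean_const_mul, signMean_memSign_mul_pow_four w hyT, Finset.sum_insert hxT]
  ring

end Moments

end SignMean

/-! ### Linear and quadratic forms in random signs -/

/-- The linear form `∑ w x * s x` in the signs `s x = memSign S x`. -/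
noncomputable def linSign {α : Type*} (T : Finset α) (w : α → ℝ) (S : Finset α) : ℝ :=
  ∑ x ∈ T, w x * memSign S x

/-- The quadratic form `∑ B x y * s x * s y` in the signs `s x = memSign S x`. -/
noncomputable def quadSign {α : Type*} (T : Finset α) (B : α → α → ℝ) (S : Finset α) : ℝ :=
  ∑ x ∈ T, ∑ y ∈ T, B x y * (memSign S x * memSign S y)

section Forms

variable {α : Type*} {T : Finset α}

lemma linSign_congr {w : α → ℝ} {S S' : Finset α} (h : ∀ z ∈ T, memSign S z = memSign S' z) :
    linSign T w S = linSign T w S' :=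
  Finset.sum_congr rfl fun z hz => by rw [h z hz]

lemma quadSign_congr {B : α → α → ℝ} {S S' : Finset α}
    (h : ∀ z ∈ T, memSign S z = memSign S' z) : quadSign T B S = quadSign T B S' :=
  Finset.sum_congr rfl fun z hz => Finset.sum_congr rfl fun t ht => by rw [h z hz, h t ht]

lemma linSign_neg {w : α → ℝ} {S S' : Finset α} (h : ∀ z ∈ T, memSign S' z = -memSign S z) :
    linSign T w S' = -linSign T w S := by
  rw [linSign, linSign, ← Finset.sum_neg_distrib]
  exact Finset.sum_congr rfl fun z hz => by rw [h z hz, mul_neg]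

lemma quadSign_neg {B : α → α → ℝ} {S S' : Finset α} (h : ∀ z ∈ T, memSign S' z = -memSign S z) :
    quadSign T B S' = quadSign T B S :=
  Finset.sum_congr rfl fun z hz => Finset.sum_congr rfl fun t ht => by
    rw [h z hz, h t ht, neg_mul_neg]

lemma linSign_insert [DecidableEq α] {x : α} (hx : x ∉ T) (w : α → ℝ) (S : Finset α) :
    linSign (insert x T) w S = w x * memSign S x + linSign T w S := by
  rw [linSign, Finset.sum_insert hx, linSign]

/-- Symmetry merges the row and the column of `x`, and the zero diagonal removes the constant term.
The form is thus affine in the sign at `x`, which drives the inductions below. -/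
lemma quadSign_insert [DecidableEq α] {x : α} (hx : x ∉ T) {B : α → α → ℝ}
    (hB : ∀ a b, B a b = B b a) (hB0 : ∀ a, B a a = 0) (S : Finset α) :
    quadSign (insert x T) B S = 2 * memSign S x * linSign T (B x) S + quadSign T B S := by
  have h₁ : ∑ y ∈ T, B x y * (memSign S x * memSign S y) = memSign S x * linSign T (B x) S := by
    rw [linSign, Finset.mul_sum]
    exact Finset.sum_congr rfl fun y _ => by ring
  have h₂ : ∑ y ∈ T, B y x * (memSign S y * memSign S x) = memSign S x * linSign T (B x) S := by
    rw [linSign, Finset.mul_sum]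
    exact Finset.sum_congr rfl fun y _ => by rw [hB y x]; ring
  simp only [quadSign, Finset.sum_insert hx, Finset.sum_add_distrib, hB0, h₁, h₂]
  ring

/-- Averaging over one sign separately, for functions of the signs. -/
lemma signMean_insert_of_eq [DecidableEq α] {x : α} (hx : x ∉ T) {F F₀ F₁ : Finset α → ℝ}
    (h₀ : ∀ S : Finset α, memSign S x = -1 → F S = F₀ S)
    (h₁ : ∀ S S' : Finset α, memSign S' x = 1 → (∀ z ∈ T, memSign S' z = memSign S z) →
      F S' = F₁ S) :
    signMean (insert x T) F = signMean T (fun S => (F₀ S + F₁ S) / 2) := by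
  rw [signMean_insert hx, show (fun S => (F₀ S + F₁ S) / 2) = fun S => 2⁻¹ * (F₀ S + F₁ S) from
    funext fun S => div_eq_inv_mul _ _, signMean_const_mul, signMean_add, div_eq_inv_mul]
  congr 2
  · exact signMean_congr fun S hS => h₀ S (memSign_of_notMem fun h => hx (hS h))
  · refine signMean_congr fun S _ => h₁ S _ (memSign_of_mem (Finset.mem_insert_self x S)) ?_
    intro z hz
    refine memSign_insert_of_ne ?_
    rintro rfl
    exact hx hz

lemma signMean_linSign_mul_linSign (u v : α → ℝ) :
    signMean T (fun S => linSign T u S * linSign T v S) = ∑ x ∈ T, u x * v x := by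
  classical
  induction T using Finset.induction_on with
  | empty => simp [signMean_empty, linSign]
  | insert x T hx ih =>
    rw [signMean_insert_of_eq hx
      (F₀ := fun S => (-u x + linSign T u S) * (-v x + linSign T v S))
      (F₁ := fun S => (u x + linSign T u S) * (v x + linSign T v S))]
    · rw [Finset.sum_insert hx, ← ih, ← signMean_const (T := T) (u x * v x), ← signMean_add]
      congr 1
      ext S
      ring
    · intro S h
      simp only [linSign_insert hx, h]
      ring
    · intro S S' h h'
      simp only [linSign_insert hx, h, linSign_congr h']
      ring

lemma signMean_quadSign {B : α → α → ℝ} (hB : ∀ a b, B a b = B b a) (hB0 : ∀ a, B a a = 0) :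
    signMean T (fun S => quadSign T B S) = 0 := by
  classical
  induction T using Finset.induction_on with
  | empty => simp [signMean_empty, quadSign]
  | insert x T hx ih =>
    rw [signMean_insert_of_eq hx
      (F₀ := fun S => -2 * linSign T (B x) S + quadSign T B S)
      (F₁ := fun S => 2 * linSign T (B x) S + quadSign T B S)]
    · rw [← ih]
      congr 1
      ext S
      ring
    · intro S h
      simp only [quadSign_insert hx hB hB0, h]
      ring
    · intro S S' h h'
      simp only [quadSign_insert hx hB hB0, h, linSign_congr h', quadSign_congr h']
      ring

lemma signMean_quadSign_mul_linSign_mul_linSign {B : α → α → ℝ} (hB : ∀ a b, B a b = B b a)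
    (hB0 : ∀ a, B a a = 0) (u v : α → ℝ) :
    signMean T (fun S => quadSign T B S * (linSign T u S * linSign T v S)) =
      2 * ∑ x ∈ T, ∑ y ∈ T, B x y * (u x * v y) := by
  classical
  induction T using Finset.induction_on with
  | empty => simp [signMean_empty, quadSign]
  | insert x T hx ih =>
    rw [signMean_insert_of_eq hx
      (F₀ := fun S => (-2 * linSign T (B x) S + quadSign T B S) *
        ((-u x + linSign T u S) * (-v x + linSign T v S)))
      (F₁ := fun S => (2 * linSign T (B x) S + quadSign T B S) *
        ((u x + linSign T u S) * (v x + linSign T v S)))]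
    · have h : signMean T (fun S => u x * v x * quadSign T B S +
          (quadSign T B S * (linSign T u S * linSign T v S) +
          (2 * u x * (linSign T (B x) S * linSign T v S) +
            2 * v x * (linSign T (B x) S * linSign T u S)))) =
          2 * ∑ a ∈ insert x T, ∑ b ∈ insert x T, B a b * (u a * v b) := by
        simp only [signMean_add, signMean_const_mul, signMean_linSign_mul_linSign, ih,
          signMean_quadSign hB hB0, Finset.sum_insert hx, Finset.sum_add_distrib, hB0]
        have h₁ : ∑ b ∈ T, B x b * (u x * v b) = u x * ∑ b ∈ T, B x b * v b := by
          rw [Finset.mul_sum]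
          exact Finset.sum_congr rfl fun b _ => by ring
        have h₂ : ∑ b ∈ T, B b x * (u b * v x) = v x * ∑ b ∈ T, B x b * u b := by
          rw [Finset.mul_sum]
          exact Finset.sum_congr rfl fun b _ => by rw [hB b x]; ring
        rw [h₁, h₂]
        ring
      rw [← h]
      congr 1
      ext S
      ring
    · intro S h
      simp only [quadSign_insert hx hB hB0, linSign_insert hx, h]
      ring
    · intro S S' h h'
      simp only [quadSign_insert hx hB hB0, linSign_insert hx, h, linSign_congr h',
        quadSign_congr h']
      ring

lemma signMean_quadSign_mul_quadSign {B C : α → α → ℝ} (hB : ∀ a b, B a b = B b a)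
    (hB0 : ∀ a, B a a = 0) (hC : ∀ a b, C a b = C b a) (hC0 : ∀ a, C a a = 0) :
    signMean T (fun S => quadSign T B S * quadSign T C S) =
      2 * ∑ x ∈ T, ∑ y ∈ T, B x y * C x y := by
  classical
  induction T using Finset.induction_on with
  | empty => simp [signMean_empty, quadSign]
  | insert x T hx ih =>
    rw [signMean_insert_of_eq hx
      (F₀ := fun S => (-2 * linSign T (B x) S + quadSign T B S) *
        (-2 * linSign T (C x) S + quadSign T C S))
      (F₁ := fun S => (2 * linSign T (B x) S + quadSign T B S) *
        (2 * linSign T (C x) S + quadSign T C S))]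
    · have h : signMean T (fun S => 4 * (linSign T (B x) S * linSign T (C x) S) +
          quadSign T B S * quadSign T C S) =
          2 * ∑ a ∈ insert x T, ∑ b ∈ insert x T, B a b * C a b := by
        simp only [signMean_add, signMean_const_mul, signMean_linSign_mul_linSign, ih,
          Finset.sum_insert hx, Finset.sum_add_distrib, hB0]
        rw [Finset.sum_congr rfl fun b (_ : b ∈ T) => show B b x * C b x = B x b * C x b by
          rw [hB b x, hC b x]]
        ring
      rw [← h]
      congr 1
      ext S
      ring
    · intro S h
      simp only [quadSign_insert hx hB hB0, quadSign_insert hx hC hC0, h]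
      ring
    · intro S S' h h'
      simp only [quadSign_insert hx hB hB0, quadSign_insert hx hC hC0, h, linSign_congr h',
        quadSign_congr h']
      ring

/-- Only monomials in which every sign occurs an even number of times survive. For three
off-diagonal pairs this forces a triangle, and 8 = 2³ counts the orderings of its three edges. -/
lemma signMean_quadSign_mul_quadSign_mul_quadSign {B C D : α → α → ℝ}
    (hB : ∀ a b, B a b = B b a) (hB0 : ∀ a, B a a = 0) (hC : ∀ a b, C a b = C b a)
    (hC0 : ∀ a, C a a = 0) (hD : ∀ a b, D a b = D b a) (hD0 : ∀ a, D a a = 0) :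
    signMean T (fun S => quadSign T B S * quadSign T C S * quadSign T D S) =
      8 * ∑ x ∈ T, ∑ y ∈ T, ∑ z ∈ T, B x y * (C x z * D y z) := by
  classical
  induction T using Finset.induction_on with
  | empty => simp [signMean_empty, quadSign]
  | insert x T hx ih =>
    rw [signMean_insert_of_eq hx
      (F₀ := fun S => (-2 * linSign T (B x) S + quadSign T B S) *
        (-2 * linSign T (C x) S + quadSign T C S) * (-2 * linSign T (D x) S + quadSign T D S))
      (F₁ := fun S => (2 * linSign T (B x) S + quadSign T B S) *
        (2 * linSign T (C x) S + quadSign T C S) * (2 * linSign T (D x) S + quadSign T D S))]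
    · have h : signMean T (fun S => quadSign T B S * quadSign T C S * quadSign T D S +
          (4 * (quadSign T B S * (linSign T (C x) S * linSign T (D x) S)) +
          (4 * (quadSign T C S * (linSign T (B x) S * linSign T (D x) S)) +
          4 * (quadSign T D S * (linSign T (B x) S * linSign T (C x) S))))) =
          8 * ∑ a ∈ insert x T, ∑ b ∈ insert x T, ∑ c ∈ insert x T, B a b * (C a c * D b c) := by
        simp only [signMean_add, signMean_const_mul, ih,
          signMean_quadSign_mul_linSign_mul_linSign hB hB0,
          signMean_quadSign_mul_linSign_mul_linSign hC hC0,
          signMean_quadSign_mul_linSign_mul_linSign hD hD0,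
          Finset.sum_insert hx, Finset.sum_add_distrib, hB0, hC0, hD0, zero_mul, mul_zero,
          Finset.sum_const_zero, zero_add]
        have h₁ : ∑ a ∈ T, ∑ b ∈ T, B a b * (C a x * D b x) =
            ∑ a ∈ T, ∑ b ∈ T, B a b * (C x a * D x b) :=
          Finset.sum_congr rfl fun a _ => Finset.sum_congr rfl fun b _ => by
            rw [hC a x, hD b x]
        have h₂ : ∑ a ∈ T, ∑ c ∈ T, B a x * (C a c * D x c) =
            ∑ a ∈ T, ∑ b ∈ T, C a b * (B x a * D x b) :=
          Finset.sum_congr rfl fun a _ => Finset.sum_congr rfl fun b _ => by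
            rw [hB a x]; ring
        have h₃ : ∑ b ∈ T, ∑ c ∈ T, B x b * (C x c * D b c) =
            ∑ a ∈ T, ∑ b ∈ T, D a b * (B x a * C x b) :=
          Finset.sum_congr rfl fun a _ => Finset.sum_congr rfl fun b _ => by ring
        rw [h₁, h₂, h₃]
        ring
      rw [← h]
      congr 1
      ext S
      ring
    · intro S h
      simp only [quadSign_insert hx hB hB0, quadSign_insert hx hC hC0,
        quadSign_insert hx hD hD0, h]
      ring
    · intro S S' h h'
      simp only [quadSign_insert hx hB hB0, quadSign_insert hx hC hC0,
        quadSign_insert hx hD hD0, h, linSign_congr h', quadSign_congr h']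
      ring

end Forms

/-! ### Biregular bipartite graphs and their codegrees -/

/-- `K` is the `0`-`1` biadjacency matrix of a `d`-regular bipartite graph with parts `T` and `U`,
each of size `M`. -/
structure IsBiregular {α β : Type*} (T : Finset α) (U : Finset β) (K : α → β → ℝ) (d M : ℝ) :
    Prop where
  idem : ∀ x y, K x y * K x y = K x y
  sum_left : ∀ y ∈ U, ∑ x ∈ T, K x y = d
  sum_right : ∀ x ∈ T, ∑ y ∈ U, K x y = d
  card_left : (T.card : ℝ) = M
  card_right : (U.card : ℝ) = M

open Classical in
/-- The number of common neighbours of two distinct vertices, and `0` on the diagonal. -/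
noncomputable def codegree {α β : Type*} (U : Finset β) (K : α → β → ℝ) (x x' : α) : ℝ :=
  if x = x' then 0 else ∑ y ∈ U, K x y * K x' y

open Classical in
/-- The adjacency matrix of the complete graph. -/
noncomputable def offDiag {α : Type*} (x x' : α) : ℝ := if x = x' then 0 else 1

section Forms

variable {α : Type*} {T : Finset α}

lemma offDiag_comm (x x' : α) : offDiag x x' = offDiag x' x := by
  by_cases h : x = x'
  · rw [h]
  · simp [offDiag, h, Ne.symm h]

lemma offDiag_self (x : α) : offDiag x x = 0 := by simp [offDiag]

lemma offDiag_mul_of_diag {B : α → α → ℝ} (hB0 : ∀ a, B a a = 0) (x x' : α) :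
    offDiag x x' * B x x' = B x x' := by
  by_cases h : x = x'
  · simp [h, hB0]
  · simp [offDiag, h]

lemma sum_sum_offDiag_mul (G : α → α → ℝ) :
    ∑ x ∈ T, ∑ y ∈ T, offDiag x y * G x y = ∑ x ∈ T, ∑ y ∈ T, G x y - ∑ x ∈ T, G x x := by
  classical
  rw [← Finset.sum_sub_distrib]
  refine Finset.sum_congr rfl fun x hx => ?_
  rw [← Finset.add_sum_erase _ _ hx, ← Finset.add_sum_erase _ (fun y => G x y) hx, offDiag_self,
    zero_mul, zero_add, add_sub_cancel_left]
  refine Finset.sum_congr rfl fun y hy => ?_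
  rw [offDiag, if_neg (Finset.ne_of_mem_erase hy).symm, one_mul]

/-- Trades a factor L² for a constant plus a quadratic form, so that the product formulas for
quadratic forms apply. -/
lemma linSign_one_sq (S : Finset α) :
    linSign T (fun _ => 1) S ^ 2 = T.card + quadSign T offDiag S := by
  rw [quadSign, sum_sum_offDiag_mul]
  simp only [memSign_mul_self, linSign, one_mul, sq, Finset.sum_mul_sum]
  simp

/-- Only off-diagonal pairs contribute, and each gives the two-sign mean. The hypothesis `hc` holds
for 0–1 weights: wherever `w x * w y` is nonzero the squares in the bracket equal 1, so `c` is 12a²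
+ 12Σw² − 16. -/
lemma signMean_quadSign_mul_pow_four {B : α → α → ℝ} (hB0 : ∀ a, B a a = 0) (w : α → ℝ)
    (a c : ℝ) (hc : ∀ x ∈ T, ∀ y ∈ T, w x * w y * (12 * a ^ 2 + 12 * (∑ z ∈ T, w z ^ 2) -
      8 * w x ^ 2 - 8 * w y ^ 2) = c * (w x * w y)) :
    signMean T (fun S => quadSign T B S * (a + linSign T w S) ^ 4) =
      c * ∑ x ∈ T, ∑ y ∈ T, B x y * (w x * w y) := by
  have h : ∀ S, quadSign T B S * (a + linSign T w S) ^ 4 = ∑ x ∈ T, ∑ y ∈ T,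
      B x y * (memSign S x * memSign S y * (a + ∑ z ∈ T, w z * memSign S z) ^ 4) := by
    intro S
    simp only [quadSign, linSign, Finset.sum_mul]
    exact Finset.sum_congr rfl fun x _ => Finset.sum_congr rfl fun y _ => by ring
  simp only [h, signMean_sum, signMean_const_mul, Finset.mul_sum]
  refine Finset.sum_congr rfl fun x hx => Finset.sum_congr rfl fun y hy => ?_
  by_cases hxy : x = y
  · simp [hxy, hB0]
  · rw [signMean_memSign_mul_memSign_mul_pow_four w hx hy hxy, hc x hx y hy]
    ring

end Forms

namespace IsBiregular

variable {α β : Type*} {T : Finset α} {U : Finset β} {K : α → β → ℝ} {d M : ℝ}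

lemma _root_.codegree_comm (x x' : α) : codegree U K x x' = codegree U K x' x := by
  by_cases h : x = x'
  · rw [h]
  · simp [codegree, h, Ne.symm h, mul_comm]

lemma _root_.codegree_self (x : α) : codegree U K x x = 0 := by simp [codegree]

/-- This is K Kᵀ = C + d·I: the diagonal entries of K Kᵀ are the degrees, as the entries of K are 0
or 1. -/
lemma sum_mul_sum (h : IsBiregular T U K d M) {x : α} (hx : x ∈ T) (x' : α) :
    ∑ y ∈ U, K x y * K x' y = codegree U K x x' + d * (1 - offDiag x x') := by
  by_cases hxx : x = x'
  · subst hxx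
    simp [codegree, offDiag, h.idem, h.sum_right x hx]
  · simp [codegree, offDiag, hxx]

lemma sum_sq (h : IsBiregular T U K d M) {y : β} (hy : y ∈ U) : ∑ x ∈ T, K x y ^ 2 = d := by
  simp only [sq, h.idem, h.sum_left y hy]

lemma sum_pow_four (h : IsBiregular T U K d M) {y : β} (hy : y ∈ U) : ∑ x ∈ T, K x y ^ 4 = d := by
  simp only [show ∀ x, K x y ^ 4 = K x y from fun x => by
    rw [show K x y ^ 4 = K x y * K x y * (K x y * K x y) by ring, h.idem, h.idem],
    h.sum_left y hy]

lemma sum_pow_six (h : IsBiregular T U K d M) {y : β} (hy : y ∈ U) : ∑ x ∈ T, K x y ^ 6 = d := by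
  simp only [show ∀ x, K x y ^ 6 = K x y from fun x => by
    rw [show K x y ^ 6 = K x y * K x y * (K x y * K x y) * (K x y * K x y) by ring, h.idem, h.idem,
      h.idem], h.sum_left y hy]

/-- Of the d² walks of length two from `x`, exactly d return to `x`. -/
lemma sum_codegree (h : IsBiregular T U K d M) {x : α} (hx : x ∈ T) :
    ∑ x' ∈ T, codegree U K x x' = d ^ 2 - d := by
  classical
  have h₁ : ∑ x' ∈ T, ∑ y ∈ U, K x y * K x' y = d ^ 2 := by
    rw [Finset.sum_comm, sq]
    nth_rewrite 1 [← h.sum_right x hx]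
    rw [Finset.sum_mul]
    refine Finset.sum_congr rfl fun y hy => ?_
    rw [← Finset.mul_sum, h.sum_left y hy]
  rw [← h₁, ← Finset.add_sum_erase _ _ hx, ← Finset.add_sum_erase T _ hx, codegree_self,
    Finset.sum_congr rfl fun y (_ : y ∈ U) => h.idem x y, h.sum_right x hx, zero_add,
    add_sub_cancel_left]
  refine Finset.sum_congr rfl fun x' hx' => ?_
  rw [codegree, if_neg (Finset.ne_of_mem_erase hx').symm]

lemma sum_sum_codegree (h : IsBiregular T U K d M) :
    ∑ x ∈ T, ∑ x' ∈ T, codegree U K x x' = M * (d ^ 2 - d) := by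
  rw [Finset.sum_congr rfl fun x hx => h.sum_codegree hx, Finset.sum_const, nsmul_eq_mul,
    h.card_left]

lemma sum_linSign (h : IsBiregular T U K d M) (S : Finset α) :
    ∑ y ∈ U, linSign T (fun x => K x y) S = d * linSign T (fun _ => 1) S := by
  simp only [linSign]
  rw [Finset.sum_comm, Finset.mul_sum]
  refine Finset.sum_congr rfl fun x hx => ?_
  rw [← Finset.sum_mul, h.sum_right x hx, one_mul]

lemma sum_linSign_sq (h : IsBiregular T U K d M) (S : Finset α) :
    ∑ y ∈ U, linSign T (fun x => K x y) S ^ 2 = M * d + quadSign T (codegree U K) S := by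
  have h₁ : ∑ y ∈ U, linSign T (fun x => K x y) S ^ 2 = ∑ x ∈ T, ∑ x' ∈ T,
      (codegree U K x x' + d * (1 - offDiag x x')) * (memSign S x * memSign S x') := by
    simp only [linSign, sq, Finset.sum_mul_sum]
    rw [Finset.sum_comm]
    refine Finset.sum_congr rfl fun x hx => ?_
    rw [Finset.sum_comm]
    refine Finset.sum_congr rfl fun x' _ => ?_
    rw [← h.sum_mul_sum hx x', Finset.sum_mul]
    exact Finset.sum_congr rfl fun y _ => by ring
  have h₂ := sum_sum_offDiag_mul (T := T) (fun x y => memSign S x * memSign S y)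
  simp only [memSign_mul_self, Finset.sum_const, nsmul_eq_mul, h.card_left, mul_one] at h₂
  have h₃ : ∀ x x' : α, (codegree U K x x' + d * (1 - offDiag x x')) *
      (memSign S x * memSign S x') = codegree U K x x' * (memSign S x * memSign S x') +
      (d * (memSign S x * memSign S x') -
        d * (offDiag x x' * (memSign S x * memSign S x'))) := fun x x' => by ring
  simp only [h₁, h₃, Finset.sum_add_distrib, Finset.sum_sub_distrib, ← Finset.mul_sum, h₂, quadSign]
  ring

/-- The conditional variance, expressed through the signs on the other side. -/
lemma sum_sq_add_linSign (h : IsBiregular T U K d M) (S : Finset α) :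
    ∑ y ∈ U, (d + linSign T (fun x => K x y) S) ^ 2 =
      M * (d ^ 2 + d) + 2 * d ^ 2 * linSign T (fun _ => 1) S + quadSign T (codegree U K) S := by
  have h₁ : ∀ y, (d + linSign T (fun x => K x y) S) ^ 2 =
      d ^ 2 + (2 * d * linSign T (fun x => K x y) S + linSign T (fun x => K x y) S ^ 2) :=
    fun y => by ring
  simp only [h₁, Finset.sum_add_distrib, ← Finset.mul_sum, h.sum_linSign, h.sum_linSign_sq,
    Finset.sum_const, nsmul_eq_mul, h.card_right]
  ring

lemma signMean_sum_pow_four (h : IsBiregular T U K d M) :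
    signMean T (fun S => ∑ y ∈ U, (d + linSign T (fun x => K x y) S) ^ 4) =
      M * (d ^ 4 + 6 * d ^ 3 + (3 * d ^ 2 - 2 * d)) := by
  simp only [signMean_sum, linSign, signMean_linear_pow_four]
  rw [← h.card_right, ← nsmul_eq_mul, ← Finset.sum_const]
  refine Finset.sum_congr rfl fun y hy => ?_
  rw [h.sum_sq hy, h.sum_pow_four hy]
  ring

lemma signMean_sum_pow_six (h : IsBiregular T U K d M) :
    signMean T (fun S => ∑ y ∈ U, (d + linSign T (fun x => K x y) S) ^ 6) =
      M * (d ^ 6 + 15 * d ^ 5 + 15 * d ^ 2 * (3 * d ^ 2 - 2 * d) +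
        (15 * d ^ 3 - 30 * d ^ 2 + 16 * d)) := by
  simp only [signMean_sum, linSign, signMean_linear_pow_six]
  rw [← h.card_right, ← nsmul_eq_mul, ← Finset.sum_const]
  refine Finset.sum_congr rfl fun y hy => ?_
  rw [h.sum_sq hy, h.sum_pow_four hy, h.sum_pow_six hy]
  ring

lemma signMean_linSign_mul_sum_pow_four (h : IsBiregular T U K d M) :
    signMean T (fun S => linSign T (fun _ => 1) S *
      ∑ y ∈ U, (d + linSign T (fun x => K x y) S) ^ 4) =
      M * d * (4 * d ^ 3 + 12 * d ^ 2 - 8 * d) := by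
  simp only [linSign, one_mul, Finset.sum_mul_sum, signMean_sum]
  rw [mul_assoc, ← h.card_left, ← nsmul_eq_mul, ← Finset.sum_const]
  refine Finset.sum_congr rfl fun x hx => ?_
  rw [← h.sum_right x hx, Finset.sum_mul, h.sum_right x hx]
  refine Finset.sum_congr rfl fun y hy => ?_
  rw [signMean_memSign_mul_pow_four _ hx, h.sum_sq hy]
  -- Uses K³ = K for the 0–1 entry, as a multiple of K² − K.
  linear_combination (-8 * d * K x y - 8 * d) * h.idem x y

lemma signMean_quadSign_mul_sum_pow_four (h : IsBiregular T U K d M) {B : α → α → ℝ}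
    (hB0 : ∀ a, B a a = 0) :
    signMean T (fun S => quadSign T B S * ∑ y ∈ U, (d + linSign T (fun x => K x y) S) ^ 4) =
      (12 * d ^ 2 + 12 * d - 16) * ∑ x ∈ T, ∑ x' ∈ T, B x x' * codegree U K x x' := by
  have h₁ : ∀ y ∈ U, signMean T (fun S =>
      quadSign T B S * (d + linSign T (fun x => K x y) S) ^ 4) = (12 * d ^ 2 + 12 * d - 16) *
        ∑ x ∈ T, ∑ x' ∈ T, B x x' * (K x y * K x' y) := by
    intro y hy
    refine signMean_quadSign_mul_pow_four hB0 _ _ _ fun x _ x' _ => ?_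
    rw [h.sum_sq hy]
    linear_combination (-8 * K x' y * K x y - 8 * K x' y) * h.idem x y +
      (-8 * K x y * K x' y - 8 * K x y) * h.idem x' y
  simp only [Finset.mul_sum (s := U), signMean_sum]
  rw [Finset.sum_congr rfl h₁, ← Finset.mul_sum, Finset.sum_comm]
  congr 1
  refine Finset.sum_congr rfl fun x hx => ?_
  rw [Finset.sum_comm]
  refine Finset.sum_congr rfl fun x' _ => ?_
  rw [← Finset.mul_sum, h.sum_mul_sum hx]
  by_cases hxx : x = x'
  · simp [hxx, hB0]
  · simp [offDiag, hxx]

lemma signMean_sq_mul_sum_pow_four (h : IsBiregular T U K d M) :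
    signMean T (fun S => linSign T (fun _ => 1) S ^ 2 *
      ∑ y ∈ U, (d + linSign T (fun x => K x y) S) ^ 4) =
      M * (M * (d ^ 4 + 6 * d ^ 3 + (3 * d ^ 2 - 2 * d))) +
        (12 * d ^ 2 + 12 * d - 16) * (M * (d ^ 2 - d)) := by
  simp only [linSign_one_sq, add_mul, signMean_add, signMean_const_mul, h.signMean_sum_pow_four,
    h.signMean_quadSign_mul_sum_pow_four offDiag_self,
    offDiag_mul_of_diag (codegree_self (U := U) (K := K)), h.sum_sum_codegree, h.card_left]

lemma signMean_quadSign_codegree_mul_pow_four (h : IsBiregular T U K d M) :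
    signMean T (fun S => quadSign T (codegree U K) S * linSign T (fun _ => 1) S ^ 4) =
      (12 * M - 16) * (M * (d ^ 2 - d)) := by
  have := signMean_quadSign_mul_pow_four (T := T) (codegree_self (U := U) (K := K)) (fun _ => 1) 0
    (12 * M - 16) (fun x _ y _ => by
      simp only [one_pow, Finset.sum_const, nsmul_eq_mul, h.card_left]
      ring)
  simpa only [zero_add, mul_one, h.sum_sum_codegree] using this

lemma signMean_quadSign_codegree_mul_sq (h : IsBiregular T U K d M) :
    signMean T (fun S => quadSign T (codegree U K) S * linSign T (fun _ => 1) S ^ 2) =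
      2 * (M * (d ^ 2 - d)) := by
  simp only [sq (linSign T _ _), signMean_quadSign_mul_linSign_mul_linSign codegree_comm
    codegree_self, mul_one, h.sum_sum_codegree]

/-- Write L² = M + (form of the complete graph). The triangle sum of that form with two copies of C
is the sum of all entries of C², which the constant row sums d² − d give, minus tr C². -/
lemma signMean_quadSign_codegree_sq_mul_sq (h : IsBiregular T U K d M) :
    signMean T (fun S => quadSign T (codegree U K) S ^ 2 * linSign T (fun _ => 1) S ^ 2) =
      M * (2 * ∑ x ∈ T, ∑ y ∈ T, codegree U K x y * codegree U K x y) +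
      8 * (M * (d ^ 2 - d) ^ 2 - ∑ x ∈ T, ∑ y ∈ T, codegree U K x y * codegree U K x y) := by
  have h₁ : ∀ S, quadSign T (codegree U K) S ^ 2 * linSign T (fun _ => 1) S ^ 2 =
      M * (quadSign T (codegree U K) S * quadSign T (codegree U K) S) +
      quadSign T offDiag S * quadSign T (codegree U K) S * quadSign T (codegree U K) S := by
    intro S
    rw [linSign_one_sq, h.card_left]
    ring
  have h₂ : ∑ x ∈ T, ∑ y ∈ T, ∑ z ∈ T, codegree U K x z * codegree U K y z =
      M * (d ^ 2 - d) ^ 2 := by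
    rw [Finset.sum_congr rfl fun x _ => Finset.sum_comm, Finset.sum_comm]
    simp only [← Finset.mul_sum, ← Finset.sum_mul]
    rw [← h.card_left, ← nsmul_eq_mul, ← Finset.sum_const]
    refine Finset.sum_congr rfl fun z hz => ?_
    rw [Finset.sum_congr rfl fun x (_ : x ∈ T) => codegree_comm (U := U) (K := K) x z,
      h.sum_codegree hz]
    ring
  simp only [h₁, signMean_add, signMean_const_mul,
    signMean_quadSign_mul_quadSign codegree_comm codegree_self codegree_comm codegree_self,
    signMean_quadSign_mul_quadSign_mul_quadSign offDiag_comm offDiag_self codegree_comm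
      codegree_self codegree_comm codegree_self, ← Finset.mul_sum, sum_sum_offDiag_mul, h₂]

end IsBiregular

/-! ### Moments of the bipartite form in terms of degree, size and codegree traces -/

namespace IsBiregular

variable {α β : Type*} {T : Finset α} {U : Finset β} {K : α → β → ℝ} {d M : ℝ}

lemma signMean_linSign_sq (h : IsBiregular T U K d M) :
    signMean T (fun S => linSign T (fun _ => 1) S ^ 2) = M := by
  have := signMean_linear_sq (T := T) (fun _ => (1 : ℝ)) 0
  simpa [linSign, h.card_left] using this

lemma signMean_linSign_pow_four (h : IsBiregular T U K d M) :
    signMean T (fun S => linSign T (fun _ => 1) S ^ 4) = 3 * M ^ 2 - 2 * M := by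
  have := signMean_linear_pow_four (T := T) (fun _ => (1 : ℝ)) 0
  simpa [linSign, h.card_left] using this

lemma signMean_linSign_pow_six (h : IsBiregular T U K d M) :
    signMean T (fun S => linSign T (fun _ => 1) S ^ 6) = 15 * M ^ 3 - 30 * M ^ 2 + 16 * M := by
  have := signMean_linear_pow_six (T := T) (fun _ => (1 : ℝ)) 0
  simp [h.card_left] at this
  simp [linSign]
  linarith

/-- Flipping every sign negates the linear form and fixes the quadratic one. -/
lemma _root_.signMean_odd_linSign (p : ℝ → ℝ → ℝ) (hp : ∀ l w, p (-l) w = -p l w) (v : α → ℝ)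
    (B : α → α → ℝ) : signMean T (fun S => p (linSign T v S) (quadSign T B S)) = 0 :=
  signMean_eq_zero_of_odd _ (fun _ _ => rfl) fun S S' hS => by
    rw [linSign_neg hS, quadSign_neg hS, hp]

/-- The mean over both sides of the graph of the `k`-th power of the quadratic polynomial
`d * ∑ s x + ∑ s y * (d + ∑ K x y * s x)` in the signs. -/
noncomputable def _root_.bipartiteMoment (T : Finset α) (U : Finset β) (K : α → β → ℝ) (d : ℝ)
    (k : ℕ) : ℝ :=
  signMean T (fun S => signMean U (fun S' => (d * linSign T (fun _ => 1) S +
    ∑ y ∈ U, (d + linSign T (fun x => K x y) S) * memSign S' y) ^ k))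

lemma bipartiteMoment_two (h : IsBiregular T U K d M) :
    bipartiteMoment T U K d 2 = M * (2 * d ^ 2 + d) := by
  have h₁ := signMean_odd_linSign (T := T) (fun l _ => l) (fun l _ => rfl) (fun _ => 1)
    (codegree U K)
  simp only [bipartiteMoment, signMean_linear_sq, h.sum_sq_add_linSign, mul_pow, signMean_add,
    signMean_const_mul, signMean_const, h.signMean_linSign_sq, h₁,
    signMean_quadSign codegree_comm codegree_self]
  ring

lemma bipartiteMoment_three (h : IsBiregular T U K d M) :
    bipartiteMoment T U K d 3 = 6 * d ^ 3 * M := by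
  have h₁ := signMean_odd_linSign (T := T)
    (fun l w => d ^ 3 * l ^ 3 + 3 * d * (M * (d ^ 2 + d)) * l + 3 * d * (l * w))
    (fun l _ => by ring) (fun _ => 1) (codegree U K)
  have h₂ : ∀ l w : ℝ, (d * l) ^ 3 + 3 * (d * l) * (M * (d ^ 2 + d) + 2 * d ^ 2 * l + w) =
      6 * d ^ 3 * l ^ 2 +
        (d ^ 3 * l ^ 3 + 3 * d * (M * (d ^ 2 + d)) * l + 3 * d * (l * w)) := fun l w => by ring
  simp only [bipartiteMoment, signMean_linear_cube, h.sum_sq_add_linSign, h₂]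
  rw [signMean_add, h₁, signMean_const_mul, h.signMean_linSign_sq, add_zero]

lemma bipartiteMoment_four (h : IsBiregular T U K d M)
    (htwo : ∑ x ∈ T, ∑ y ∈ T, codegree U K x y * codegree U K x y = M * (2 * d ^ 2 - 2 * d)) :
    bipartiteMoment T U K d 4 =
      d * M * (12 * d ^ 3 * M + 12 * d ^ 2 * M + 20 * d ^ 3 + 3 * d * M - 24 * d ^ 2
        + 6 * d - 8) := by
  have h₁ := signMean_odd_linSign (T := T)
    (fun l w => 12 * d ^ 4 * l ^ 3 + 12 * d ^ 2 * (M * (d ^ 2 + d)) * l + 12 * d ^ 2 * (l * w))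
    (fun l _ => by ring) (fun _ => 1) (codegree U K)
  -- Here `l`, `w`, `q` stand for L, Q and Σ w_y⁴. The first bracket is the part odd in L, killed by
  -- `h₁`; the rest is nested so that linearity of the mean splits it term by term.
  have h₂ : ∀ l w q : ℝ, (d * l) ^ 4 + 6 * (d * l) ^ 2 * (M * (d ^ 2 + d) + 2 * d ^ 2 * l + w) +
      (3 * (M * (d ^ 2 + d) + 2 * d ^ 2 * l + w) ^ 2 - 2 * q) =
      (12 * d ^ 4 * l ^ 3 + 12 * d ^ 2 * (M * (d ^ 2 + d)) * l + 12 * d ^ 2 * (l * w)) +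
      (d ^ 4 * l ^ 4 + ((6 * d ^ 2 * (M * (d ^ 2 + d)) + 12 * d ^ 4) * l ^ 2 +
      (6 * d ^ 2 * (w * l ^ 2) + (3 * (M * (d ^ 2 + d)) ^ 2 +
      (6 * (M * (d ^ 2 + d)) * w + (3 * (w * w) + (-2) * q)))))) := fun l w q => by ring
  simp only [bipartiteMoment, signMean_linear_pow_four, h.sum_sq_add_linSign, h₂]
  rw [signMean_add, h₁]
  simp only [signMean_add, signMean_const_mul, signMean_const, h.signMean_linSign_sq,
    h.signMean_linSign_pow_four, h.signMean_quadSign_codegree_mul_sq,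
    signMean_quadSign (codegree_comm (U := U) (K := K)) codegree_self,
    signMean_quadSign_mul_quadSign (codegree_comm (U := U) (K := K)) codegree_self codegree_comm
      codegree_self, htwo, h.signMean_sum_pow_four]
  ring

/-- No codegree trace enters: Q² occurs only multiplied by L, and that product is odd. -/
lemma bipartiteMoment_five (h : IsBiregular T U K d M) :
    bipartiteMoment T U K d 5 =
      10 * d ^ 3 * M * (12 * d ^ 2 * M + 6 * d * M + 4 * d ^ 2 - 24 * d + 8) := by
  have h₁ := signMean_odd_linSign (T := T)
    (fun l w => d ^ 5 * l ^ 5 + 10 * d ^ 3 * l ^ 3 * (M * (d ^ 2 + d) + w) +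
      15 * d * l * ((M * (d ^ 2 + d) + w) ^ 2 + 4 * d ^ 4 * l ^ 2))
    (fun l _ => by ring) (fun _ => 1) (codegree U K)
  have h₂ : ∀ l w q : ℝ, (d * l) ^ 5 + 10 * (d * l) ^ 3 *
      (M * (d ^ 2 + d) + 2 * d ^ 2 * l + w) +
      5 * (d * l) * (3 * (M * (d ^ 2 + d) + 2 * d ^ 2 * l + w) ^ 2 - 2 * q) =
      (d ^ 5 * l ^ 5 + 10 * d ^ 3 * l ^ 3 * (M * (d ^ 2 + d) + w) +
        15 * d * l * ((M * (d ^ 2 + d) + w) ^ 2 + 4 * d ^ 4 * l ^ 2)) +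
      (20 * d ^ 5 * l ^ 4 + (60 * d ^ 3 * (M * (d ^ 2 + d)) * l ^ 2 + (60 * d ^ 3 * (w * l ^ 2) +
        (-10) * d * (l * q)))) := fun l w q => by ring
  simp only [bipartiteMoment, signMean_linear_pow_five, h.sum_sq_add_linSign, h₂]
  rw [signMean_add, h₁]
  simp only [signMean_add, signMean_const_mul, h.signMean_linSign_sq,
    h.signMean_linSign_pow_four, h.signMean_quadSign_codegree_mul_sq,
    h.signMean_linSign_mul_sum_pow_four]
  ring

lemma bipartiteMoment_six (h : IsBiregular T U K d M)
    (htwo : ∑ x ∈ T, ∑ y ∈ T, codegree U K x y * codegree U K x y = M * (2 * d ^ 2 - 2 * d))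
    (hthree : ∑ x ∈ T, ∑ y ∈ T, ∑ z ∈ T,
      codegree U K x y * (codegree U K x z * codegree U K y z) =
        M * (8 * d * (d - 1) * (d - 2))) :
    bipartiteMoment T U K d 6 =
      d * M * (120 * d ^ 5 * M ^ 2 + 180 * d ^ 4 * M ^ 2 + 960 * d ^ 5 * M + 90 * d ^ 3 * M ^ 2
        - 420 * d ^ 4 * M - 448 * d ^ 5 + 15 * d ^ 2 * M ^ 2 - 180 * d ^ 3 * M - 1320 * d ^ 4
        - 150 * d ^ 2 * M + 960 * d ^ 3 - 120 * d * M + 960 * d ^ 2 - 1680 * d + 1216) := by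
  obtain ⟨c, hc⟩ : ∃ c, c = M * (d ^ 2 + d) := ⟨_, rfl⟩
  have h₁ := signMean_odd_linSign (T := T)
    (fun l w => 30 * d ^ 6 * l ^ 5 + 180 * d ^ 4 * l ^ 3 * (c + w) +
      15 * (6 * d ^ 2 * l * (c + w) ^ 2 + 8 * d ^ 6 * l ^ 3))
    (fun l _ => by ring) (fun _ => 1) (codegree U K)
  -- Here `r` is Σ w_y⁶. The terms with `q` stay outside the odd part, since Σ w_y⁴ has no definite
  -- parity under a global flip.
  have h₂ : ∀ l w q r : ℝ, (d * l) ^ 6 + 15 * (d * l) ^ 4 * (c + 2 * d ^ 2 * l + w) +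
      15 * (d * l) ^ 2 * (3 * (c + 2 * d ^ 2 * l + w) ^ 2 - 2 * q) +
      (15 * (c + 2 * d ^ 2 * l + w) ^ 3 - 30 * (c + 2 * d ^ 2 * l + w) * q + 16 * r) =
      (30 * d ^ 6 * l ^ 5 + 180 * d ^ 4 * l ^ 3 * (c + w) +
        15 * (6 * d ^ 2 * l * (c + w) ^ 2 + 8 * d ^ 6 * l ^ 3)) +
      (d ^ 6 * l ^ 6 + ((15 * d ^ 4 * c + 180 * d ^ 6) * l ^ 4 + (15 * d ^ 4 * (w * l ^ 4) +
      ((45 * d ^ 2 * c ^ 2 + 180 * d ^ 4 * c) * l ^ 2 +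
      ((90 * d ^ 2 * c + 180 * d ^ 4) * (w * l ^ 2) + (45 * d ^ 2 * (w ^ 2 * l ^ 2) +
      ((-30) * d ^ 2 * (l ^ 2 * q) + (15 * c ^ 3 + (45 * c ^ 2 * w + (45 * c * (w * w) +
      (15 * (w * w * w) + ((-30) * c * q + ((-60) * d ^ 2 * (l * q) + ((-30) * (w * q) +
        16 * r)))))))))))))) := fun l w q r => by ring
  simp only [bipartiteMoment, signMean_linear_pow_six, h.sum_sq_add_linSign, ← hc, h₂]
  rw [signMean_add, h₁]
  simp only [signMean_add, signMean_const_mul, signMean_const, h.signMean_linSign_sq,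
    h.signMean_linSign_pow_four, h.signMean_linSign_pow_six, h.signMean_quadSign_codegree_mul_sq,
    h.signMean_quadSign_codegree_mul_pow_four, h.signMean_quadSign_codegree_sq_mul_sq,
    h.signMean_sq_mul_sum_pow_four,
    signMean_quadSign (codegree_comm (U := U) (K := K)) codegree_self,
    signMean_quadSign_mul_quadSign (codegree_comm (U := U) (K := K)) codegree_self codegree_comm
      codegree_self,
    signMean_quadSign_mul_quadSign_mul_quadSign (codegree_comm (U := U) (K := K)) codegree_self
      codegree_comm codegree_self codegree_comm codegree_self,
    htwo, hthree, h.signMean_sum_pow_four, h.signMean_linSign_mul_sum_pow_four,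
    h.signMean_quadSign_mul_sum_pow_four codegree_self, h.signMean_sum_pow_six, hc]
  ring

end IsBiregular

/-! ### The cube as a bipartite graph -/

section CubeGraph

variable {n : ℕ}

/-- The neighbour of `x` in direction `i`. -/
def flipAt (i : Fin n) (x : Cube n) : Cube n := Function.update x i (!x i)

/-- The character of the cube that belongs to the set `U` of coordinates. -/
noncomputable def cubeChar (U : Finset (Fin n)) (x : Cube n) : ℝ :=
  ∏ i ∈ U, if x i then -1 else 1

open Classical in
/-- The vertices of even weight. -/
noncomputable def evenVertices (n : ℕ) : Finset (Cube n) :=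
  Finset.univ.filter fun x => cubeChar Finset.univ x = 1

open Classical in
/-- The vertices of odd weight. -/
noncomputable def oddVertices (n : ℕ) : Finset (Cube n) :=
  Finset.univ.filter fun x => cubeChar Finset.univ x = -1

open Classical in
/-- The adjacency matrix of the cube graph. -/
noncomputable def cubeAdj (x y : Cube n) : ℝ := if ∃ i, flipAt i x = y then 1 else 0

lemma flipAt_flipAt (i : Fin n) (x : Cube n) : flipAt i (flipAt i x) = x := by
  simp [flipAt]

lemma flipAt_eq_iff {i : Fin n} {x y : Cube n} : flipAt i x = y ↔ flipAt i y = x := by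
  constructor <;> rintro rfl <;> exact flipAt_flipAt i _

lemma flipAt_injective_left (x : Cube n) : Function.Injective fun i => flipAt i x := by
  intro i j hij
  by_contra hne
  have := congrFun hij i
  simp [flipAt, hne] at this

lemma cubeChar_mul_self (U : Finset (Fin n)) (x : Cube n) : cubeChar U x * cubeChar U x = 1 := by
  rw [cubeChar, ← Finset.prod_mul_distrib]
  refine Finset.prod_eq_one fun i _ => ?_
  split_ifs <;> norm_num

/-- Flipping coordinate `i` changes one factor precisely when `i ∈ U`. Since `memSign U i` is +1 on
`U`, the adjacency eigenvalue is minus the sum of the signs, which explains the minus signs below.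
-/
lemma cubeChar_flipAt (U : Finset (Fin n)) (i : Fin n) (x : Cube n) :
    cubeChar U (flipAt i x) = -memSign U i * cubeChar U x := by
  classical
  by_cases hi : i ∈ U
  · rw [cubeChar, cubeChar, ← Finset.mul_prod_erase _ _ hi, ← Finset.mul_prod_erase _ _ hi,
      memSign_of_mem hi, Finset.prod_congr rfl fun j hj => show
        (if flipAt i x j then (-1 : ℝ) else 1) = if x j then -1 else 1 by
          rw [flipAt, Function.update_of_ne (Finset.ne_of_mem_erase hj)]]
    cases h : x i <;> simp [flipAt, h]
  · rw [memSign_of_notMem hi, neg_neg, one_mul, cubeChar, cubeChar]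
    refine Finset.prod_congr rfl fun j hj => ?_
    rw [flipAt, Function.update_of_ne]
    rintro rfl
    exact hi hj

lemma sum_cubeChar_flipAt (U : Finset (Fin n)) (x : Cube n) :
    ∑ i, cubeChar U (flipAt i x) = -(∑ i, memSign U i) * cubeChar U x := by
  simp only [cubeChar_flipAt, ← Finset.sum_mul, Finset.sum_neg_distrib]

lemma mem_evenVertices {x : Cube n} : x ∈ evenVertices n ↔ cubeChar Finset.univ x = 1 := by
  simp [evenVertices]

lemma mem_oddVertices {x : Cube n} : x ∈ oddVertices n ↔ cubeChar Finset.univ x = -1 := by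
  simp [oddVertices]

lemma flipAt_mem_oddVertices {i : Fin n} {x : Cube n} :
    flipAt i x ∈ oddVertices n ↔ x ∈ evenVertices n := by
  simp [mem_evenVertices, mem_oddVertices, cubeChar_flipAt, memSign]

lemma flipAt_mem_evenVertices {i : Fin n} {x : Cube n} :
    flipAt i x ∈ evenVertices n ↔ x ∈ oddVertices n := by
  rw [← flipAt_mem_oddVertices (i := i), flipAt_flipAt]

lemma disjoint_evenVertices_oddVertices (n : ℕ) :
    Disjoint (evenVertices n) (oddVertices n) := by
  rw [Finset.disjoint_left]
  intro x hx hx'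
  rw [mem_evenVertices] at hx
  rw [mem_oddVertices, hx] at hx'
  norm_num at hx'

lemma evenVertices_union_oddVertices (n : ℕ) [DecidableEq (Cube n)] :
    evenVertices n ∪ oddVertices n = Finset.univ := by
  ext x
  simp only [Finset.mem_union, mem_evenVertices, mem_oddVertices, Finset.mem_univ, iff_true]
  exact mul_self_eq_one_iff.1 (cubeChar_mul_self _ x)

lemma card_evenVertices_eq_card_oddVertices (hn : n ≠ 0) :
    (evenVertices n).card = (oddVertices n).card := by
  let i : Fin n := ⟨0, Nat.pos_of_ne_zero hn⟩
  refine Finset.card_nbij' (flipAt i) (flipAt i) ?_ ?_ ?_ ?_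
  · exact fun x hx => flipAt_mem_oddVertices.2 hx
  · exact fun x hx => flipAt_mem_evenVertices.2 hx
  · exact fun x _ => flipAt_flipAt i x
  · exact fun x _ => flipAt_flipAt i x

lemma card_evenVertices_add_card_oddVertices (n : ℕ) :
    ((evenVertices n).card : ℝ) + (oddVertices n).card = 2 ^ n := by
  classical
  rw [← Nat.cast_add, ← Finset.card_union_of_disjoint (disjoint_evenVertices_oddVertices n),
    evenVertices_union_oddVertices]
  simp

open Classical in
lemma cubeAdj_eq_sum (x y : Cube n) : cubeAdj x y = ∑ i, if flipAt i x = y then 1 else 0 := by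
  rw [cubeAdj]
  split_ifs with h
  · obtain ⟨i, rfl⟩ := h
    simp [(flipAt_injective_left x).eq_iff]
  · push Not at h
    simp [h]

lemma cubeAdj_comm (x y : Cube n) : cubeAdj x y = cubeAdj y x := by
  classical
  simp only [cubeAdj, flipAt_eq_iff]

lemma sum_oddVertices_cubeAdj_mul {x : Cube n} (hx : x ∈ evenVertices n) (F : Cube n → ℝ) :
    ∑ y ∈ oddVertices n, cubeAdj x y * F y = ∑ i, F (flipAt i x) := by
  classical
  simp only [cubeAdj_eq_sum, Finset.sum_mul]
  rw [Finset.sum_comm]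
  refine Finset.sum_congr rfl fun i _ => ?_
  simp [flipAt_mem_oddVertices.2 hx]

lemma sum_evenVertices_cubeAdj_mul {y : Cube n} (hy : y ∈ oddVertices n) (F : Cube n → ℝ) :
    ∑ x ∈ evenVertices n, cubeAdj x y * F x = ∑ i, F (flipAt i y) := by
  classical
  simp only [cubeAdj_comm _ y, cubeAdj_eq_sum, Finset.sum_mul]
  rw [Finset.sum_comm]
  refine Finset.sum_congr rfl fun i _ => ?_
  simp [flipAt_mem_evenVertices.2 hy]

lemma isBiregular_cubeAdj (hn : n ≠ 0) :
    IsBiregular (evenVertices n) (oddVertices n) cubeAdj (n : ℝ) (2 ^ n / 2) := by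
  have h₁ := card_evenVertices_add_card_oddVertices n
  have h₂ : ((evenVertices n).card : ℝ) = (oddVertices n).card := by
    rw [card_evenVertices_eq_card_oddVertices hn]
  refine ⟨fun x y => ?_, fun y hy => ?_, fun x hx => ?_, by linarith, by linarith⟩
  · simp [cubeAdj]
  · simpa using sum_evenVertices_cubeAdj_mul hy fun _ => 1
  · simpa using sum_oddVertices_cubeAdj_mul hx fun _ => 1

/-! ### Codegree traces from the spectrum of the cube -/

/-- The `k`-th power of minus the adjacency matrix of the cube graph, in spectral form. -/
noncomputable def cubePower (k : ℕ) (x y : Cube n) : ℝ :=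
  (∑ U : Finset (Fin n), (∑ i, memSign U i) ^ k * (cubeChar U x * cubeChar U y)) / 2 ^ n

lemma cubePower_comm (k : ℕ) (x y : Cube n) : cubePower k x y = cubePower k y x := by
  simp only [cubePower, mul_comm (cubeChar _ x)]

/-- Orthogonality of characters: the sum over `U` factors over coordinates, with factor 2 where `x`
and `y` agree and 0 where they differ. -/
lemma cubePower_zero (x y : Cube n) : cubePower 0 x y = 1 - offDiag x y := by
  classical
  have h : ∑ U : Finset (Fin n), cubeChar U x * cubeChar U y =
      ∏ i : Fin n, ((if x i then (-1 : ℝ) else 1) * (if y i then -1 else 1) + 1) := by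
    rw [Finset.prod_add_one, Finset.powerset_univ]
    exact Finset.sum_congr rfl fun U _ => by rw [cubeChar, cubeChar, Finset.prod_mul_distrib]
  simp only [cubePower, pow_zero, one_mul, h]
  by_cases hxy : x = y
  · subst hxy
    rw [offDiag_self, Finset.prod_congr rfl fun i _ => show
      ((if x i then (-1 : ℝ) else 1) * (if x i then -1 else 1) + 1) = 2 by
        split_ifs <;> norm_num]
    simp
  · obtain ⟨i, hi⟩ := Function.ne_iff.1 hxy
    rw [Finset.prod_eq_zero (Finset.mem_univ i), offDiag, if_neg hxy]
    · simp
    · revert hi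
      cases x i <;> cases y i <;> simp

lemma sum_cubePower_flipAt (k : ℕ) (x y : Cube n) :
    ∑ i, cubePower k (flipAt i x) y = -cubePower (k + 1) x y := by
  simp only [cubePower]
  rw [← Finset.sum_div, Finset.sum_comm, ← neg_div, ← Finset.sum_neg_distrib]
  congr 1
  refine Finset.sum_congr rfl fun U _ => ?_
  rw [← Finset.mul_sum, ← Finset.sum_mul, sum_cubeChar_flipAt]
  ring

/-- On the diagonal the characters square to 1, leaving a moment of a sum of n random signs, so the
linear-form formulas apply again. -/
lemma cubePower_diag (k : ℕ) (x : Cube n) :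
    cubePower k x x = signMean Finset.univ fun U : Finset (Fin n) =>
      (∑ i, memSign U i) ^ k := by
  simp [cubePower, signMean, cubeChar_mul_self]

lemma cubePower_two_diag (x : Cube n) : cubePower 2 x x = n := by
  have := signMean_linear_sq (T := (Finset.univ : Finset (Fin n))) (fun _ => (1 : ℝ)) 0
  simpa [cubePower_diag] using this

lemma cubePower_four_diag (x : Cube n) : cubePower 4 x x = 3 * (n : ℝ) ^ 2 - 2 * n := by
  have := signMean_linear_pow_four (T := (Finset.univ : Finset (Fin n))) (fun _ => (1 : ℝ)) 0
  simpa [cubePower_diag] using this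

lemma cubePower_six_diag (x : Cube n) :
    cubePower 6 x x = 15 * (n : ℝ) ^ 3 - 30 * n ^ 2 + 16 * n := by
  have := signMean_linear_pow_six (T := (Finset.univ : Finset (Fin n))) (fun _ => (1 : ℝ)) 0
  simp only [zero_add, one_mul, one_pow, Finset.sum_const, Finset.card_univ, Fintype.card_fin,
    nsmul_eq_mul, mul_one] at this
  rw [cubePower_diag, this]
  ring

/-- On even vertices C = A² − nI. Applying A twice raises the power by two, and the two minus signs
cancel. -/
lemma sum_codegree_cubeAdj_mul_cubePower (hn : n ≠ 0) {x : Cube n} (hx : x ∈ evenVertices n)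
    (k : ℕ) (z : Cube n) :
    ∑ y ∈ evenVertices n, codegree (oddVertices n) cubeAdj x y * cubePower k y z =
      cubePower (k + 2) x z - n * cubePower k x z := by
  classical
  have h₁ : ∀ y, codegree (oddVertices n) cubeAdj x y * cubePower k y z =
      ∑ t ∈ oddVertices n, cubeAdj x t * (cubeAdj y t * cubePower k y z) -
        n * (if x = y then cubePower k y z else 0) := by
    intro y
    have := (isBiregular_cubeAdj hn).sum_mul_sum hx y
    simp only [← mul_assoc, ← Finset.sum_mul, this, offDiag]
    split_ifs <;> ring
  simp only [h₁, Finset.sum_sub_distrib, ← Finset.mul_sum, Finset.sum_ite_eq, hx, if_true]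
  congr 1
  rw [Finset.sum_comm]
  simp only [← Finset.mul_sum]
  rw [sum_oddVertices_cubeAdj_mul hx]
  rw [Finset.sum_congr rfl fun i _ => by
    rw [sum_evenVertices_cubeAdj_mul (flipAt_mem_oddVertices.2 hx), sum_cubePower_flipAt],
    Finset.sum_neg_distrib, sum_cubePower_flipAt, neg_neg]

lemma codegree_cubeAdj (hn : n ≠ 0) {x y : Cube n} (hx : x ∈ evenVertices n)
    (hy : y ∈ evenVertices n) :
    codegree (oddVertices n) cubeAdj x y = cubePower 2 x y - n * cubePower 0 x y := by
  classical
  -- Apply the previous lemma with k = 0, where the kernel `cubePower 0` is the identity matrix.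
  rw [← zero_add 2, ← sum_codegree_cubeAdj_mul_cubePower hn hx]
  rw [Finset.sum_eq_single y]
  · simp [cubePower_zero, offDiag]
  · intro z _ hz
    simp [cubePower_zero, offDiag, hz]
  · exact fun h => (h hy).elim

lemma sum_codegree_mul_codegree (hn : n ≠ 0) {x y : Cube n} (hx : x ∈ evenVertices n)
    (hy : y ∈ evenVertices n) :
    ∑ z ∈ evenVertices n, codegree (oddVertices n) cubeAdj x z *
      codegree (oddVertices n) cubeAdj y z =
      cubePower 4 x y - 2 * n * cubePower 2 x y + n ^ 2 * cubePower 0 x y := by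
  have h : ∀ z ∈ evenVertices n, codegree (oddVertices n) cubeAdj x z *
      codegree (oddVertices n) cubeAdj y z =
      codegree (oddVertices n) cubeAdj x z * cubePower 2 z y -
        n * (codegree (oddVertices n) cubeAdj x z * cubePower 0 z y) := by
    intro z hz
    rw [codegree_cubeAdj hn hy hz, cubePower_comm 2 y z, cubePower_comm 0 y z]
    ring
  rw [Finset.sum_congr rfl h, Finset.sum_sub_distrib, ← Finset.mul_sum,
    sum_codegree_cubeAdj_mul_cubePower hn hx, sum_codegree_cubeAdj_mul_cubePower hn hx]
  ring

lemma sum_codegree_sq (hn : n ≠ 0) :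
    ∑ x ∈ evenVertices n, ∑ y ∈ evenVertices n, codegree (oddVertices n) cubeAdj x y *
      codegree (oddVertices n) cubeAdj x y = 2 ^ n / 2 * (2 * (n : ℝ) ^ 2 - 2 * n) := by
  rw [← (isBiregular_cubeAdj hn).card_left, ← nsmul_eq_mul, ← Finset.sum_const]
  refine Finset.sum_congr rfl fun x hx => ?_
  rw [sum_codegree_mul_codegree hn hx hx, cubePower_four_diag, cubePower_two_diag, cubePower_zero,
    offDiag_self]
  ring

/-- For each `x` this is a diagonal entry of (A² − nI)³ = A⁶ − 3nA⁴ + 3n²A² − n³I. -/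
lemma sum_codegree_triangle (hn : n ≠ 0) :
    ∑ x ∈ evenVertices n, ∑ y ∈ evenVertices n, ∑ z ∈ evenVertices n,
      codegree (oddVertices n) cubeAdj x y * (codegree (oddVertices n) cubeAdj x z *
        codegree (oddVertices n) cubeAdj y z) =
      2 ^ n / 2 * (8 * (n : ℝ) * (n - 1) * (n - 2)) := by
  rw [← (isBiregular_cubeAdj hn).card_left, ← nsmul_eq_mul, ← Finset.sum_const]
  refine Finset.sum_congr rfl fun x hx => ?_
  have h : ∀ y ∈ evenVertices n, ∑ z ∈ evenVertices n, codegree (oddVertices n) cubeAdj x y *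
      (codegree (oddVertices n) cubeAdj x z * codegree (oddVertices n) cubeAdj y z) =
      codegree (oddVertices n) cubeAdj x y * cubePower 4 y x - (2 * n *
        (codegree (oddVertices n) cubeAdj x y * cubePower 2 y x) - n ^ 2 *
          (codegree (oddVertices n) cubeAdj x y * cubePower 0 y x)) := by
    intro y hy
    rw [← Finset.mul_sum, sum_codegree_mul_codegree hn hx hy, cubePower_comm 4 x,
      cubePower_comm 2 x, cubePower_comm 0 x]
    ring
  rw [Finset.sum_congr rfl h]
  simp only [Finset.sum_sub_distrib, ← Finset.mul_sum, sum_codegree_cubeAdj_mul_cubePower hn hx]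
  simp only [zero_add, Nat.reduceAdd, cubePower_six_diag, cubePower_four_diag, cubePower_two_diag,
    cubePower_zero, offDiag_self]
  ring

end CubeGraph

/-! ### From edge counts to the bipartite form -/

section Reduction

open MeasureTheory ProbabilityTheory Filter Topology

variable {n : ℕ}

lemma integral_randomSubset (F : Finset (Cube n) → ℝ) :
    ∫ S, F S ∂(randomSubset n) = signMean Finset.univ F := by
  rw [randomSubset, PMF.integral_eq_sum]
  simp [signMean, Finset.mul_sum, div_eq_inv_mul]

lemma isSubcube_one_iff {C : Finset (Cube n)} :
    IsSubcube 1 C ↔ ∃ (i : Fin n) (y : Cube n), ∀ x, x ∈ C ↔ x = y ∨ x = flipAt i y := by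
  have key : ∀ (i : Fin n) (x y : Cube n),
      (∀ j, j ∉ ({i} : Finset (Fin n)) → x j = y j) ↔ x = y ∨ x = flipAt i y := by
    intro i x y
    constructor
    · intro h
      by_cases hi : x i = y i
      · left
        funext j
        by_cases hj : j = i
        · rw [hj, hi]
        · exact h j (by simpa using hj)
      · right
        funext j
        by_cases hj : j = i
        · subst hj
          simpa [flipAt] using Bool.eq_not.2 hi
        · simpa [flipAt, hj] using h j (by simpa using hj)
    · rintro (rfl | rfl) j hj
      · rfl
      · simp only [Finset.mem_singleton] at hj
        simp [flipAt, hj]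
  constructor
  · rintro ⟨J, a, hJ, hC⟩
    obtain ⟨i, rfl⟩ := Finset.card_eq_one.1 hJ
    exact ⟨i, a, fun x => (hC x).trans (key i x a)⟩
  · rintro ⟨i, y, hC⟩
    exact ⟨{i}, y, Finset.card_singleton i, fun x => (hC x).trans (key i x y).symm⟩

open Classical in
/-- The edges contained in `S`, enumerated by their odd endpoint and their direction. -/
lemma numSubcubes_one_eq_card (S : Finset (Cube n)) :
    numSubcubes n 1 S = (((oddVertices n ×ˢ Finset.univ).filter
      fun p : Cube n × Fin n => p.1 ∈ S ∧ flipAt p.2 p.1 ∈ S).card : ℝ) := by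
  rw [numSubcubes, Nat.cast_inj]
  symm
  refine Finset.card_bij (fun p _ => {p.1, flipAt p.2 p.1}) ?_ ?_ ?_
  · rintro ⟨y, i⟩ hp
    simp only [Finset.mem_filter, Finset.mem_product, Finset.mem_univ, and_true] at hp
    simp only [subcubes, Finset.mem_filter, Finset.mem_univ, true_and]
    refine ⟨isSubcube_one_iff.2 ⟨i, y, fun x => by simp⟩, ?_⟩
    simp [Finset.insert_subset_iff, hp.2.1, hp.2.2]
  · rintro ⟨y, i⟩ hp ⟨z, j⟩ hq heq
    simp only [Finset.mem_filter, Finset.mem_product, Finset.mem_univ, and_true] at hp hq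
    simp only at heq
    -- Each edge has exactly one odd endpoint: were `y` the other endpoint of the edge at `z`, it
    -- would be even.
    have hyz : y = z := by
      have : y ∈ ({z, flipAt j z} : Finset (Cube n)) := heq ▸ Finset.mem_insert_self _ _
      rw [Finset.mem_insert, Finset.mem_singleton] at this
      refine this.resolve_right fun h => ?_
      exact Finset.disjoint_left.1 (disjoint_evenVertices_oddVertices n)
        (flipAt_mem_evenVertices.2 hq.1) (h ▸ hp.1)
    subst hyz
    have : flipAt i y ∈ ({y, flipAt j y} : Finset (Cube n)) := by
      rw [← heq]
      simp
    rw [Finset.mem_insert, Finset.mem_singleton] at this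
    have hij := this.resolve_left fun h => Finset.disjoint_left.1
      (disjoint_evenVertices_oddVertices n) (flipAt_mem_evenVertices.2 hp.1) (h.symm ▸ hp.1)
    rw [flipAt_injective_left y hij]
  · intro C hC
    simp only [subcubes, Finset.mem_filter, Finset.mem_univ, true_and] at hC
    obtain ⟨i, y, hy⟩ := isSubcube_one_iff.1 hC.1
    have hyS : y ∈ S := hC.2 ((hy y).2 (Or.inl rfl))
    have hyS' : flipAt i y ∈ S := hC.2 ((hy _).2 (Or.inr rfl))
    have hmem : y ∈ evenVertices n ∪ oddVertices n := by
      rw [evenVertices_union_oddVertices]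
      exact Finset.mem_univ y
    rcases Finset.mem_union.1 hmem with he | ho
    · refine ⟨(flipAt i y, i), ?_, ?_⟩
      · simp [flipAt_mem_oddVertices.2 he, flipAt_flipAt, hyS, hyS']
      · ext x
        simp [hy, flipAt_flipAt, or_comm]
    · refine ⟨(y, i), ?_, ?_⟩
      · simp [ho, hyS, hyS']
      · ext x
        simp [hy]

/-- The indicator of membership is (1 + sign)/2 at each endpoint. -/
lemma numSubcubes_one_eq_sum (S : Finset (Cube n)) :
    numSubcubes n 1 S = 1 / 4 * ∑ y ∈ oddVertices n, ∑ i : Fin n,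
      (1 + memSign S y) * (1 + memSign S (flipAt i y)) := by
  classical
  rw [numSubcubes_one_eq_card, Finset.card_filter, Nat.cast_sum, Finset.sum_product,
    Finset.mul_sum]
  refine Finset.sum_congr rfl fun y _ => ?_
  rw [Finset.mul_sum]
  refine Finset.sum_congr rfl fun i _ => ?_
  by_cases h₁ : y ∈ S <;> by_cases h₂ : flipAt i y ∈ S <;> simp [memSign, h₁, h₂]
  norm_num

lemma numSubcubes_one_eq_linSign (hn : n ≠ 0) (S : Finset (Cube n)) :
    numSubcubes n 1 S = 1 / 4 * (n * (2 ^ n / 2) + (n * linSign (evenVertices n) (fun _ => 1) S +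
      ∑ y ∈ oddVertices n, (n + linSign (evenVertices n) (fun x => cubeAdj x y) S) *
        memSign S y)) := by
  have h := isBiregular_cubeAdj hn
  have h₁ : ∀ y ∈ oddVertices n, ∑ i : Fin n, (1 + memSign S y) * (1 + memSign S (flipAt i y)) =
      n + (linSign (evenVertices n) (fun x => cubeAdj x y) S +
        (n + linSign (evenVertices n) (fun x => cubeAdj x y) S) * memSign S y) := by
    intro y hy
    rw [← Finset.mul_sum, Finset.sum_add_distrib, ← sum_evenVertices_cubeAdj_mul hy, linSign]
    simp
    ring
  rw [numSubcubes_one_eq_sum, Finset.sum_congr rfl h₁]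
  simp only [Finset.sum_add_distrib (f := fun _ => (n : ℝ)), Finset.sum_const, nsmul_eq_mul,
    h.card_right, Finset.sum_add_distrib (f := fun y => linSign (evenVertices n) _ S),
    h.sum_linSign]
  ring

/-- Averaging over the odd vertices, then over the even ones. -/
lemma integral_randomSubset_comp (hn : n ≠ 0) (g : ℝ → ℝ) :
    ∫ S, g (numSubcubes n 1 S) ∂(randomSubset n) =
      signMean (evenVertices n) fun S => signMean (oddVertices n) fun S' =>
        g (1 / 4 * (n * (2 ^ n / 2) + (n * linSign (evenVertices n) (fun _ => 1) S +
          ∑ y ∈ oddVertices n, (n + linSign (evenVertices n) (fun x => cubeAdj x y) S) *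
            memSign S' y))) := by
  classical
  rw [integral_randomSubset, ← evenVertices_union_oddVertices,
    signMean_union (disjoint_evenVertices_oddVertices n)]
  refine signMean_congr fun S hS => signMean_congr fun S' hS' => ?_
  have he : ∀ x ∈ evenVertices n, memSign (S ∪ S') x = memSign S x := by
    intro x hx
    have : x ∉ S' := fun h =>
      Finset.disjoint_left.1 (disjoint_evenVertices_oddVertices n) hx (hS' h)
    simp [memSign, this]
  have ho : ∀ x ∈ oddVertices n, memSign (S ∪ S') x = memSign S' x := by
    intro x hx
    have : x ∉ S := fun h =>
      Finset.disjoint_left.1 (disjoint_evenVertices_oddVertices n) (hS h) hx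
    simp [memSign, this]
  rw [numSubcubes_one_eq_linSign hn, linSign_congr he]
  congr 4
  refine Finset.sum_congr rfl fun y hy => ?_
  rw [linSign_congr he, ho y hy]

lemma integral_numSubcubes_one (hn : n ≠ 0) :
    ∫ S, numSubcubes n 1 S ∂(randomSubset n) = 1 / 4 * (n * (2 ^ n / 2)) := by
  have h : ∀ (T : Finset (Cube n)) (w : Cube n → ℝ),
      signMean T (fun S => ∑ x ∈ T, w x * memSign S x) = 0 := fun T w => by
    simpa using signMean_linear_one w 0
  rw [integral_randomSubset_comp hn (fun r => r)]
  simp only [signMean_const_mul, signMean_add, signMean_const, h, linSign, mul_zero, add_zero]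

lemma centralMoment_numSubcubes_one (hn : n ≠ 0) (k : ℕ) :
    centralMoment (numSubcubes n 1) k (randomSubset n) =
      bipartiteMoment (evenVertices n) (oddVertices n) cubeAdj n k / 4 ^ k := by
  rw [centralMoment, integral_numSubcubes_one hn]
  simp only [Pi.pow_apply, Pi.sub_apply]
  rw [integral_randomSubset_comp hn (fun r => (r - 1 / 4 * (n * (2 ^ n / 2))) ^ k),
    bipartiteMoment, div_eq_inv_mul _ ((4 : ℝ) ^ k), ← inv_pow]
  simp only [← signMean_const_mul, ← mul_pow]
  congr 1
  ext S
  congr 1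
  ext S'
  congr 1
  ring

lemma numSubcubes_zero_one : numSubcubes 0 1 = fun _ => 0 := by
  funext S
  rw [numSubcubes_one_eq_sum]
  simp

/-- Dimension 0 is separate: the parts then have sizes 1 and 0, so `isBiregular_cubeAdj` is
unavailable. -/
lemma centralMoment_numSubcubes_zero {k : ℕ} (hk : k ≠ 0) :
    centralMoment (numSubcubes 0 1) k (randomSubset 0) = 0 := by
  simp [centralMoment, numSubcubes_zero_one, hk]

lemma variance_numSubcubes_one (n : ℕ) :
    variance (numSubcubes n 1) (randomSubset n) = n * 2 ^ n * (2 * n + 1) / 32 := by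
  rw [← centralMoment_two_eq_variance .of_discrete]
  rcases eq_or_ne n 0 with rfl | hn
  · simp [centralMoment_numSubcubes_zero]
  · rw [centralMoment_numSubcubes_one hn, (isBiregular_cubeAdj hn).bipartiteMoment_two]
    ring

lemma scaledCentralMoment_eq (n k : ℕ) :
    scaledCentralMoment n 1 k = centralMoment (numSubcubes n 1) k (randomSubset n) /
      √(n * 2 ^ n * (2 * n + 1) / 32) ^ k := by
  rw [scaledCentralMoment, variance_numSubcubes_one, centralMoment]
  simp only [div_pow, Pi.pow_apply, Pi.sub_apply]
  exact integral_div _ _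

lemma centralMoment_three (n : ℕ) :
    centralMoment (numSubcubes n 1) 3 (randomSubset n) = 3 * (n : ℝ) ^ 3 * 2 ^ n / 64 := by
  rcases eq_or_ne n 0 with rfl | hn
  · simp [centralMoment_numSubcubes_zero]
  · rw [centralMoment_numSubcubes_one hn, (isBiregular_cubeAdj hn).bipartiteMoment_three]
    ring

lemma centralMoment_four (n : ℕ) :
    centralMoment (numSubcubes n 1) 4 (randomSubset n) =
      (n : ℝ) * 2 ^ n / 1024 *
        (12 * (n : ℝ) ^ 3 * 2 ^ n + 12 * (n : ℝ) ^ 2 * 2 ^ n + 40 * (n : ℝ) ^ 3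
          + 3 * (n : ℝ) * 2 ^ n - 48 * (n : ℝ) ^ 2 + 12 * (n : ℝ) - 16) := by
  rcases eq_or_ne n 0 with rfl | hn
  · simp [centralMoment_numSubcubes_zero]
  · rw [centralMoment_numSubcubes_one hn,
      (isBiregular_cubeAdj hn).bipartiteMoment_four (sum_codegree_sq hn)]
    ring

lemma centralMoment_five (n : ℕ) :
    centralMoment (numSubcubes n 1) 5 (randomSubset n) =
      5 * (n : ℝ) ^ 3 * 2 ^ n / 1024 *
        (6 * (n : ℝ) ^ 2 * 2 ^ n + 3 * (n : ℝ) * 2 ^ n + 4 * (n : ℝ) ^ 2 - 24 * (n : ℝ) + 8) := by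
  rcases eq_or_ne n 0 with rfl | hn
  · simp [centralMoment_numSubcubes_zero]
  · rw [centralMoment_numSubcubes_one hn, (isBiregular_cubeAdj hn).bipartiteMoment_five]
    ring

lemma centralMoment_six (n : ℕ) :
    centralMoment (numSubcubes n 1) 6 (randomSubset n) =
      (n : ℝ) * 2 ^ n / 32768 *
        (120 * (n : ℝ) ^ 5 * (2 ^ n) ^ 2 + 180 * (n : ℝ) ^ 4 * (2 ^ n) ^ 2
          + 1920 * (n : ℝ) ^ 5 * 2 ^ n + 90 * (n : ℝ) ^ 3 * (2 ^ n) ^ 2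
          - 840 * (n : ℝ) ^ 4 * 2 ^ n - 1792 * (n : ℝ) ^ 5
          + 15 * (n : ℝ) ^ 2 * (2 ^ n) ^ 2 - 360 * (n : ℝ) ^ 3 * 2 ^ n
          - 5280 * (n : ℝ) ^ 4 - 300 * (n : ℝ) ^ 2 * 2 ^ n + 3840 * (n : ℝ) ^ 3
          - 240 * (n : ℝ) * 2 ^ n + 3840 * (n : ℝ) ^ 2 - 6720 * (n : ℝ) + 4864) := by
  rcases eq_or_ne n 0 with rfl | hn
  · simp [centralMoment_numSubcubes_zero]
  · rw [centralMoment_numSubcubes_one hn, (isBiregular_cubeAdj hn).bipartiteMoment_six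
      (sum_codegree_sq hn) (sum_codegree_triangle hn)]
    ring

end Reduction

/-! ### Limits of the scaled moments -/

section Limits

open MeasureTheory ProbabilityTheory Filter Topology

lemma tendsto_of_abs_sub_le_div_two_pow {f : ℕ → ℝ} {c C : ℝ}
    (h : ∀ n : ℕ, n ≠ 0 → |f n - c| ≤ C / 2 ^ n) : Tendsto f atTop (𝓝 c) := by
  have hC : Tendsto (fun n : ℕ => C / 2 ^ n) atTop (𝓝 0) :=
    Tendsto.div_atTop tendsto_const_nhds (tendsto_pow_atTop_atTop_of_one_lt one_lt_two)
  rw [tendsto_iff_norm_sub_tendsto_zero]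
  refine squeeze_zero' (Eventually.of_forall fun n => norm_nonneg _) ?_ hC
  filter_upwards [eventually_ne_atTop 0] with n hn using h n hn

/-- Used for odd orders, where squaring removes the square root of the variance. -/
lemma tendsto_zero_of_sq_le_div_two_pow {f : ℕ → ℝ} {C : ℝ}
    (h : ∀ n : ℕ, n ≠ 0 → f n ^ 2 ≤ C / 2 ^ n) : Tendsto f atTop (𝓝 0) := by
  have h₁ : Tendsto (fun n => f n ^ 2) atTop (𝓝 0) :=
    tendsto_of_abs_sub_le_div_two_pow fun n hn => by
      rw [sub_zero, abs_of_nonneg (sq_nonneg _)]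
      exact h n hn
  have h₂ := (Real.continuous_sqrt.tendsto 0).comp h₁
  rw [Real.sqrt_zero] at h₂
  rw [tendsto_zero_iff_abs_tendsto_zero]
  exact h₂.congr fun n => Real.sqrt_sq_eq_abs _

lemma sqrt_pow_two_mul {v : ℝ} (hv : 0 ≤ v) (k : ℕ) : √v ^ (2 * k) = v ^ k := by
  rw [pow_mul, Real.sq_sqrt hv]

variable {n : ℕ}

lemma one_le_cast_of_ne_zero (hn : n ≠ 0) : (1 : ℝ) ≤ n := by
  exact_mod_cast Nat.one_le_iff_ne_zero.2 hn

lemma tendsto_scaledCentralMoment_three :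
    Tendsto (fun n : ℕ => scaledCentralMoment n 1 3) atTop (𝓝 0) := by
  refine tendsto_zero_of_sq_le_div_two_pow (C := 9) fun n hn => ?_
  have hx := one_le_cast_of_ne_zero hn
  have hN : (0 : ℝ) < 2 ^ n := by positivity
  rw [scaledCentralMoment_eq, centralMoment_three, div_pow, ← pow_mul, mul_comm 3 2,
    sqrt_pow_two_mul (by positivity)]
  generalize (2 : ℝ) ^ n = N at *
  generalize (n : ℝ) = x at *
  rw [div_le_div_iff₀ (by positivity) hN]
  -- The squared scaled moment is 72x³ / ((2x + 1)³N), hence the constant 9 = 72/8.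
  have h : 8 * x ^ 3 ≤ (2 * x + 1) ^ 3 := by nlinarith [pow_nonneg (zero_le_one.trans hx) 2]
  have h₁ : 0 ≤ x ^ 3 * N ^ 3 := by positivity
  nlinarith [mul_le_mul_of_nonneg_left h h₁]

lemma tendsto_scaledCentralMoment_four :
    Tendsto (fun n : ℕ => scaledCentralMoment n 1 4) atTop (𝓝 3) := by
  refine tendsto_of_abs_sub_le_div_two_pow (C := 116) fun n hn => ?_
  have hx := one_le_cast_of_ne_zero hn
  have hN : (0 : ℝ) < 2 ^ n := by positivity
  rw [scaledCentralMoment_eq, centralMoment_four, show (4 : ℕ) = 2 * 2 from rfl,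
    sqrt_pow_two_mul (by positivity)]
  generalize (2 : ℝ) ^ n = N at *
  generalize (n : ℝ) = x at *
  have hx0 : 0 < x := by linarith
  -- Since 12x³ + 12x² + 3x = 3x(2x + 1)², the N² part is exactly 3·Var². The constant 116 is the
  -- sum of the absolute coefficients left over.
  have h : x * N / 1024 * (12 * x ^ 3 * N + 12 * x ^ 2 * N + 40 * x ^ 3 + 3 * x * N - 48 * x ^ 2 +
      12 * x - 16) / (x * N * (2 * x + 1) / 32) ^ 2 - 3 =
      (40 * x ^ 3 - 48 * x ^ 2 + 12 * x - 16) / (x * (2 * x + 1) ^ 2) / N := by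
    field_simp
    ring
  rw [h, abs_div, abs_of_pos hN]
  gcongr
  rw [abs_div, abs_of_pos (by positivity : 0 < x * (2 * x + 1) ^ 2), div_le_iff₀ (by positivity),
    abs_le]
  have h₂ : x ≤ x ^ 3 := le_self_pow₀ hx (by norm_num)
  have h₃ : x ^ 2 ≤ x ^ 3 := pow_le_pow_right₀ hx (by norm_num)
  constructor <;> nlinarith

lemma tendsto_scaledCentralMoment_five :
    Tendsto (fun n : ℕ => scaledCentralMoment n 1 5) atTop (𝓝 0) := by
  refine tendsto_zero_of_sq_le_div_two_pow (C := 25 * 45 ^ 2) fun n hn => ?_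
  have hx := one_le_cast_of_ne_zero hn
  have hN : (1 : ℝ) ≤ 2 ^ n := one_le_pow₀ one_le_two
  rw [scaledCentralMoment_eq, centralMoment_five, div_pow, ← pow_mul, mul_comm 5 2,
    sqrt_pow_two_mul (by positivity)]
  generalize (2 : ℝ) ^ n = N at *
  generalize (n : ℝ) = x at *
  have hx0 : 0 < x := by linarith
  have hN0 : 0 < N := by linarith
  -- 45 is the sum of the absolute coefficients, each monomial being at most x²N.
  have h₁ : |6 * x ^ 2 * N + 3 * x * N + 4 * x ^ 2 - 24 * x + 8| ≤ 45 * (x ^ 2 * N) := by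
    have h₂ : x ≤ x ^ 2 := le_self_pow₀ hx (by norm_num)
    have h₃ : x * N ≤ x ^ 2 * N := by gcongr
    have h₄ : x ^ 2 ≤ x ^ 2 * N := le_mul_of_one_le_right (by positivity) hN
    rw [abs_le]
    constructor <;> nlinarith
  have h₅ : (6 * x ^ 2 * N + 3 * x * N + 4 * x ^ 2 - 24 * x + 8) ^ 2 ≤ (45 * (x ^ 2 * N)) ^ 2 :=
    sq_le_sq.2 (h₁.trans (le_abs_self _))
  have h₆ : (2 * x) ^ 5 ≤ (2 * x + 1) ^ 5 := by gcongr; linarith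
  rw [div_le_div_iff₀ (by positivity) hN0]
  calc (5 * x ^ 3 * N / 1024 * (6 * x ^ 2 * N + 3 * x * N + 4 * x ^ 2 - 24 * x + 8)) ^ 2 * N
      = 25 * x ^ 6 * N ^ 3 / 1024 ^ 2 *
          (6 * x ^ 2 * N + 3 * x * N + 4 * x ^ 2 - 24 * x + 8) ^ 2 := by ring
    _ ≤ 25 * x ^ 6 * N ^ 3 / 1024 ^ 2 * (45 * (x ^ 2 * N)) ^ 2 := by gcongr
    _ = 25 * 45 ^ 2 * (x ^ 5 * N ^ 5 / 32 ^ 5 * (2 * x) ^ 5) := by ring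
    _ ≤ 25 * 45 ^ 2 * (x ^ 5 * N ^ 5 / 32 ^ 5 * (2 * x + 1) ^ 5) := by gcongr
    _ = 25 * 45 ^ 2 * (x * N * (2 * x + 1) / 32) ^ 5 := by ring

lemma tendsto_scaledCentralMoment_six :
    Tendsto (fun n : ℕ => scaledCentralMoment n 1 6) atTop (𝓝 15) := by
  refine tendsto_of_abs_sub_le_div_two_pow (C := 30000) fun n hn => ?_
  have hx := one_le_cast_of_ne_zero hn
  have hN : (1 : ℝ) ≤ 2 ^ n := one_le_pow₀ one_le_two
  rw [scaledCentralMoment_eq, centralMoment_six, show (6 : ℕ) = 2 * 3 from rfl,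
    sqrt_pow_two_mul (by positivity)]
  generalize (2 : ℝ) ^ n = N at *
  generalize (n : ℝ) = x at *
  have hx0 : 0 < x := by linarith
  have hN0 : 0 < N := by linarith
  -- Since 120x⁵ + 180x⁴ + 90x³ + 15x² = 15x²(2x + 1)³, the N³ part is exactly 15·Var³. The
  -- coefficients left over sum in absolute value to 3660 and 26336, together below 30000.
  have h : x * N / 32768 * (120 * x ^ 5 * N ^ 2 + 180 * x ^ 4 * N ^ 2 + 1920 * x ^ 5 * N +
      90 * x ^ 3 * N ^ 2 - 840 * x ^ 4 * N - 1792 * x ^ 5 + 15 * x ^ 2 * N ^ 2 - 360 * x ^ 3 * N -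
      5280 * x ^ 4 - 300 * x ^ 2 * N + 3840 * x ^ 3 - 240 * x * N + 3840 * x ^ 2 - 6720 * x +
      4864) / (x * N * (2 * x + 1) / 32) ^ 3 - 15 =
      ((1920 * x ^ 5 - 840 * x ^ 4 - 360 * x ^ 3 - 300 * x ^ 2 - 240 * x) * N +
      (-1792 * x ^ 5 - 5280 * x ^ 4 + 3840 * x ^ 3 + 3840 * x ^ 2 - 6720 * x + 4864)) /
        (x ^ 2 * N * (2 * x + 1) ^ 3) / N := by
    field_simp
    ring
  rw [h, abs_div _ N, abs_of_pos hN0]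
  gcongr
  rw [abs_div, abs_of_pos (by positivity : 0 < x ^ 2 * N * (2 * x + 1) ^ 3),
    div_le_iff₀ (by positivity)]
  have h₀ : 1 ≤ x ^ 5 := one_le_pow₀ hx
  have h₁ : x ≤ x ^ 5 := le_self_pow₀ hx (by norm_num)
  have h₂ : x ^ 2 ≤ x ^ 5 := pow_le_pow_right₀ hx (by norm_num)
  have h₃ : x ^ 3 ≤ x ^ 5 := pow_le_pow_right₀ hx (by norm_num)
  have h₄ : x ^ 4 ≤ x ^ 5 := pow_le_pow_right₀ hx (by norm_num)
  have h₅ : |1920 * x ^ 5 - 840 * x ^ 4 - 360 * x ^ 3 - 300 * x ^ 2 - 240 * x| ≤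
      3660 * x ^ 5 := by
    rw [abs_le]
    constructor <;> nlinarith
  have h₆ : |-1792 * x ^ 5 - 5280 * x ^ 4 + 3840 * x ^ 3 + 3840 * x ^ 2 - 6720 * x + 4864| ≤
      26336 * x ^ 5 := by
    rw [abs_le]
    constructor <;> nlinarith
  have h₇ : x ^ 3 ≤ (2 * x + 1) ^ 3 := by gcongr; linarith
  refine (abs_add_le _ _).trans ?_
  rw [abs_mul, abs_of_pos hN0]
  calc _ ≤ 3660 * x ^ 5 * N + 26336 * x ^ 5 * N := by
        refine add_le_add (by gcongr) (h₆.trans ?_)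
        exact le_mul_of_one_le_right (by positivity) hN
    _ ≤ 30000 * (x ^ 2 * N * x ^ 3) := by nlinarith [show 0 ≤ x ^ 5 * N by positivity]
    _ ≤ 30000 * (x ^ 2 * N * (2 * x + 1) ^ 3) := by gcongr

end Limits

theorem mainTheorem3 :
    (∀ n : ℕ,
      ProbabilityTheory.centralMoment (numSubcubes n 1) 3 (randomSubset n) =
        3 * (n : ℝ) ^ 3 * 2 ^ n / 64) ∧
    (∀ n : ℕ,
      ProbabilityTheory.centralMoment (numSubcubes n 1) 4 (randomSubset n) =
        (n : ℝ) * 2 ^ n / 1024 *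
          (12 * (n : ℝ) ^ 3 * 2 ^ n + 12 * (n : ℝ) ^ 2 * 2 ^ n + 40 * (n : ℝ) ^ 3
            + 3 * (n : ℝ) * 2 ^ n - 48 * (n : ℝ) ^ 2 + 12 * (n : ℝ) - 16)) ∧
    (∀ n : ℕ,
      ProbabilityTheory.centralMoment (numSubcubes n 1) 5 (randomSubset n) =
        5 * (n : ℝ) ^ 3 * 2 ^ n / 1024 *
          (6 * (n : ℝ) ^ 2 * 2 ^ n + 3 * (n : ℝ) * 2 ^ n + 4 * (n : ℝ) ^ 2
            - 24 * (n : ℝ) + 8)) ∧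
    (∀ n : ℕ,
      ProbabilityTheory.centralMoment (numSubcubes n 1) 6 (randomSubset n) =
        (n : ℝ) * 2 ^ n / 32768 *
          (120 * (n : ℝ) ^ 5 * (2 ^ n) ^ 2 + 180 * (n : ℝ) ^ 4 * (2 ^ n) ^ 2
            + 1920 * (n : ℝ) ^ 5 * 2 ^ n + 90 * (n : ℝ) ^ 3 * (2 ^ n) ^ 2
            - 840 * (n : ℝ) ^ 4 * 2 ^ n - 1792 * (n : ℝ) ^ 5
            + 15 * (n : ℝ) ^ 2 * (2 ^ n) ^ 2 - 360 * (n : ℝ) ^ 3 * 2 ^ n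
            - 5280 * (n : ℝ) ^ 4 - 300 * (n : ℝ) ^ 2 * 2 ^ n + 3840 * (n : ℝ) ^ 3
            - 240 * (n : ℝ) * 2 ^ n + 3840 * (n : ℝ) ^ 2 - 6720 * (n : ℝ) + 4864)) ∧
    Filter.Tendsto (fun n : ℕ => scaledCentralMoment n 1 3) Filter.atTop (nhds 0) ∧
    Filter.Tendsto (fun n : ℕ => scaledCentralMoment n 1 4) Filter.atTop (nhds 3) ∧
    Filter.Tendsto (fun n : ℕ => scaledCentralMoment n 1 5) Filter.atTop (nhds 0) ∧
    Filter.Tendsto (fun n : ℕ => scaledCentralMoment n 1 6) Filter.atTop (nhds 15) :=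
  ⟨centralMoment_three, centralMoment_four, centralMoment_five, centralMoment_six,
    tendsto_scaledCentralMoment_three, tendsto_scaledCentralMoment_four,
    tendsto_scaledCentralMoment_five, tendsto_scaledCentralMoment_six⟩
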